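/- Let a finite graph be cellularly embedded in the torus (for example a square lattice with periodic boundary conditions), with vertices $s$, edges $e$ and faces (plaquettes) $p$, and put a qubit on every edge. The toric code Hamiltonian on $(\mathbb C^2)^{\otimes\,\mathrm{edges}}$ is $H=-U\sum_s A_s-J\sum_p B_p$ with $U,J>0$, where $A_s=\prod_{e\in\mathrm{legs}(s)}\sigma^x_e$ and $B_p=\prod_{e\in\partial p}\sigma^z_e$ (edges counted with multiplicity). Let $W^z_1,W^z_2$ be products of $\sigma^z$ along closed loops of the graph, and $W^x_1,W^x_2$ products of $\sigma^x$ along closed loops of the dual graph, around the two directions $1,2$ of the torus: the loops of $W^z_i$ and $W^x_j$ cross an odd number of times if $i\ne j$ and an even number of times if $i=j$. Put $$|\psi_I\rangle=N\prod_p\frac{1+B_p}{2}\;\frac{1+W^z_1}{2}\,|{+}\cdots{+}\rangle,\qquad |\psi_e\rangle=W^x_2|\psi_I\rangle,\quad |\psi_m\rangle=W^z_2|\psi_I\rangle,\quad |\psi_{em}\rangle=W^x_2W^z_2|\psi_I\rangle,$$ where $N>0$ normalizes $|\psi_I\rangle$. Divide the set of edges into two complementary regions $A$ and $B$ that are non-contractible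 in direction $1$, that is, each of them contains a loop that is homologous (mod $2$) to the loop of $W^z_1$. Suppose that $A$ and $B$ share exactly two boundaries, which are disjoint simple closed curves. Here the boundary between $A$ and $B$ is the curve that crosses exactly those corners (angles between consecutive edges at a vertex, inside a face) that have one edge in $A$ and one in $B$, running alternately through faces and vertices; it is a disjoint union of simple closed curves if it passes at most once through each face and each vertex. Let $n^{(1)}_{AB}$ and $n^{(2)}_{AB}$ be the numbers of plaquettes spanning the first and the second boundary. Then the normalized ground states of $H$ are exactly the vectors $|\psi\rangle=\sum_{i\in\{I,e,m,em\}}c_i|\psi_i\rangle$ with $\sum_i|c_i|^2=1$, and the logarithmic negativity $E_{\mathcal N}^{A|B}(\rho)=\log_2\operatorname{tr}|\rho^{T_A}|$ (with $T_A$ the partial transposition on $A$ and $|O|=\sqrt{O^\dagger O}$) of each of them is $$E_{\mathcal N}^{A|B}\big(|\psi\rangle\langle\psi|\big)=2\log_2\sum_i|c_i|+\big(n^{(1)}_{AB}-1\big)+\big(n^{(2)}_{AB}-1\big).$$ -/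

import Mathlib

open scoped Matrix MatrixOrder

noncomputable section

/-! ### Graphs on closed oriented surfaces -/

/-- A finite graph cellularly embedded in a closed oriented surface, given by its rotation system.
The elements of `D` are the darts (half-edges): `rot` turns a dart to the next dart at the same
vertex, `rev` sends a dart to the other half of the same edge. -/
structure CombMap (D : Type*) where
  rot : Equiv.Perm D
  rev : Equiv.Perm D
  rev_rev : ∀ d, rev (rev d) = d
  rev_ne : ∀ d, rev d ≠ d

namespace CombMap

variable {D : Type*} (M : CombMap D)

/-- Vertices are the orbits of `rot`. -/
def Vertex : Type _ := Quotient (Equiv.Perm.SameCycle.setoid M.rot)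

/-- Edges are the orbits of `rev`. -/
def Edge : Type _ := Quotient (Equiv.Perm.SameCycle.setoid M.rev)

/-- Faces (plaquettes) are the orbits of `rot * rev`: run along a dart to its other end, then turn
to the next dart there. -/
def Face : Type _ := Quotient (Equiv.Perm.SameCycle.setoid (M.rot * M.rev))

/-- The vertex at which a dart is based. -/
def vertex (d : D) : M.Vertex := Quotient.mk _ d

/-- The edge of a dart. -/
def edge (d : D) : M.Edge := Quotient.mk _ d

/-- The face along which a dart runs. -/
def face (d : D) : M.Face := Quotient.mk _ d

instance [Finite D] : Finite M.Vertex := inferInstanceAs (Finite (Quotient _))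
instance [Finite D] : Finite M.Edge := inferInstanceAs (Finite (Quotient _))
instance [Finite D] : Finite M.Face := inferInstanceAs (Finite (Quotient _))
instance [Finite D] : Fintype M.Vertex := Fintype.ofFinite _
instance [Finite D] : Fintype M.Edge := Fintype.ofFinite _
instance [Finite D] : Fintype M.Face := Fintype.ofFinite _
instance : DecidableEq M.Vertex := Classical.decEq _
instance : DecidableEq M.Edge := Classical.decEq _
instance : DecidableEq M.Face := Classical.decEq _

/-- The surface is connected and has Euler characteristic `0`, that is, it is a torus. -/
structure IsTorus : Prop where
  connected : ∀ d d' : D, ∃ g ∈ Subgroup.closure {M.rot, M.rev}, g d = d'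
  euler : Nat.card M.Vertex + Nat.card M.Face = Nat.card M.Edge

/-- How often the edge `e` occurs among the legs of the vertex `v` (twice for a loop at `v`). -/
def legMult (v : M.Vertex) (e : M.Edge) : ℕ := Nat.card {d : D // M.vertex d = v ∧ M.edge d = e}

/-- How often the edge `e` occurs in the boundary walk of the face `p`. -/
def bdryMult (p : M.Face) (e : M.Edge) : ℕ := Nat.card {d : D // M.face d = p ∧ M.edge d = e}

section Loops

variable [Finite D]

/-- Closed loops on the graph, as `ℤ/2`-chains of edges (`γ e` is the parity of the number of
times that the loop uses `e`): the loop meets every vertex an even number of times. -/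
def IsLoop (γ : M.Edge → ZMod 2) : Prop := ∀ v, ∑ e, (M.legMult v e : ZMod 2) * γ e = 0

/-- Closed loops on the dual graph, as sets of crossed edges: the loop crosses the boundary of
every face an even number of times. -/
def IsDualLoop (δ : M.Edge → ZMod 2) : Prop := ∀ p, ∑ e, (M.bdryMult p e : ZMod 2) * δ e = 0

/-- The parity of the number of crossings of a loop and a dual loop. -/
def crossing (γ δ : M.Edge → ZMod 2) : ZMod 2 := ∑ e, γ e * δ e

/-- `γ'` is obtained from `γ` by a deformation across a set `T` of faces. -/
def Homologous (γ γ' : M.Edge → ZMod 2) : Prop :=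
  ∃ T : M.Face → ZMod 2, ∀ e, γ' e = γ e + ∑ p, T p * (M.bdryMult p e : ZMod 2)

/-- A complete set of loops and dual loops on the torus, around its two directions `1` and `2`:
a loop and a dual loop cross an odd number of times exactly when their directions differ. -/
structure LoopSystem where
  z₁ : M.Edge → ZMod 2
  z₂ : M.Edge → ZMod 2
  x₁ : M.Edge → ZMod 2
  x₂ : M.Edge → ZMod 2
  loop₁ : M.IsLoop z₁
  loop₂ : M.IsLoop z₂
  dual₁ : M.IsDualLoop x₁
  dual₂ : M.IsDualLoop x₂
  cross₁₁ : M.crossing z₁ x₁ = 0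
  cross₁₂ : M.crossing z₁ x₂ = 1
  cross₂₁ : M.crossing z₂ x₁ = 1
  cross₂₂ : M.crossing z₂ x₂ = 0

/-- The region `R` goes around the torus parallel to the loop `γ`: a deformation of `γ` is contained
in `R`. For a non-contractible loop `γ` this makes `R` non-contractible. -/
def WindsAlong (R : Finset M.Edge) (γ : M.Edge → ZMod 2) : Prop :=
  ∃ γ', M.Homologous γ γ' ∧ ∀ e, γ' e ≠ 0 → e ∈ R

end Loops

/-! ### The boundary between a region `A` of edges and its complement

The corner of a dart `d` is the angle between `d` and `rot d`; it lies at the vertex of `d`, in the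
face of `rot d`. The boundary crosses the corners whose two edges are in different regions, running
alternately through faces and vertices. -/

/-- The face in which the corner of the dart `d` lies. -/
def cornerFace (d : D) : M.Face := M.face (M.rot d)

/-- The boundary between `A` and its complement crosses the corner of `d`. -/
def IsCut (A : Finset M.Edge) (d : D) : Prop := ¬ (M.edge d ∈ A ↔ M.edge (M.rot d) ∈ A)

/-- The boundary between `A` and its complement consists of disjoint simple closed curves: it passes
through each vertex and each face at most once (entering and leaving by one corner each). -/
def HasSimpleBoundary (A : Finset M.Edge) : Prop :=
  (∀ v, Nat.card {d : D // M.IsCut A d ∧ M.vertex d = v} ≤ 2) ∧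
  (∀ p, Nat.card {d : D // M.IsCut A d ∧ M.cornerFace d = p} ≤ 2)

/-- Two crossed corners are on the same boundary curve if one gets from one to the other through
vertices and faces, along crossed corners. -/
def boundarySetoid (A : Finset M.Edge) : Setoid {d : D // M.IsCut A d} :=
  Relation.EqvGen.setoid fun c c' =>
    M.vertex c.1 = M.vertex c'.1 ∨ M.cornerFace c.1 = M.cornerFace c'.1

/-- The boundary curves between `A` and its complement. -/
def Boundary (A : Finset M.Edge) : Type _ := Quotient (M.boundarySetoid A)

/-- The number of plaquettes spanning the boundary curve `Γ`. -/
def numPlaquettes (A : Finset M.Edge) (Γ : M.Boundary A) : ℕ :=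
  Nat.card {p : M.Face // ∃ c : {d : D // M.IsCut A d},
    (Quotient.mk _ c : M.Boundary A) = Γ ∧ M.cornerFace c.1 = p}

end CombMap

/-! ### Qubits -/

section Qubits

variable {E : Type*} [Fintype E] [DecidableEq E]

def pauliX : Matrix (Fin 2) (Fin 2) ℂ := !![0, 1; 1, 0]

def pauliZ : Matrix (Fin 2) (Fin 2) ℂ := !![1, 0; 0, -1]

/-- The tensor product of the one-qubit operators `P e`, as a matrix in the computational basis of
`(ℂ²)^{⊗ E}`, which is indexed by `E → Fin 2`. -/
def tensorOp (P : E → Matrix (Fin 2) (Fin 2) ℂ) : Matrix (E → Fin 2) (E → Fin 2) ℂ :=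
  Matrix.of fun s t => ∏ e, P e (s e) (t e)

theorem tensorOp_mul (P Q : E → Matrix (Fin 2) (Fin 2) ℂ) :
    tensorOp P * tensorOp Q = tensorOp (fun e => P e * Q e) := by
  ext s t
  simp only [tensorOp, Matrix.mul_apply, Matrix.of_apply, ← Finset.prod_mul_distrib]
  rw [Finset.prod_univ_sum, Fintype.piFinset_univ]

/-- The product of Pauli operators `σˣ`, with exponent `k e` on the qubit `e`. -/
def xOp (k : E → ℕ) : Matrix (E → Fin 2) (E → Fin 2) ℂ := tensorOp fun e => pauliX ^ k e

/-- The product of Pauli operators `σᶻ`, with exponent `k e` on the qubit `e`. -/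
def zOp (k : E → ℕ) : Matrix (E → Fin 2) (E → Fin 2) ℂ := tensorOp fun e => pauliZ ^ k e

theorem zOp_commute (k l : E → ℕ) : Commute (zOp k) (zOp l) := by
  simp only [Commute, SemiconjBy, zOp, tensorOp_mul, ← pow_add, add_comm]

/-- The product state `|+⋯+⟩`. -/
def plusState : (E → Fin 2) → ℂ := fun _ => ∏ _e : E, ((√2 : ℝ) : ℂ)⁻¹

/-- The norm of the Hilbert space `(ℂ²)^{⊗ E}`. -/
def stateNorm (ψ : (E → Fin 2) → ℂ) : ℝ := √(∑ s, ‖ψ s‖ ^ 2)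

/-- The vector `N • ψ`, where `N > 0` makes it a unit vector. -/
def normalized (ψ : (E → Fin 2) → ℂ) : (E → Fin 2) → ℂ := ((stateNorm ψ : ℝ) : ℂ)⁻¹ • ψ

/-- Ground states: the normalized eigenvectors of `H` with the lowest eigenvalue. -/
def IsGroundState (H : Matrix (E → Fin 2) (E → Fin 2) ℂ) (ψ : (E → Fin 2) → ℂ) : Prop :=
  stateNorm ψ = 1 ∧ ∃ E₀ : ℝ, H *ᵥ ψ = (E₀ : ℂ) • ψ ∧
    ∀ (E₁ : ℝ) (φ : (E → Fin 2) → ℂ), φ ≠ 0 → H *ᵥ φ = (E₁ : ℂ) • φ → E₀ ≤ E₁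

/-- The density matrix `|ψ⟩⟨ψ|`. -/
def pureState (ψ : (E → Fin 2) → ℂ) : Matrix (E → Fin 2) (E → Fin 2) ℂ :=
  Matrix.vecMulVec ψ (star ψ)

/-- The partial transposition `ρ^{T_A}`, which exchanges the row and column indices of the qubits
in `A`. -/
def partialTranspose (A : Finset E) (ρ : Matrix (E → Fin 2) (E → Fin 2) ℂ) :
    Matrix (E → Fin 2) (E → Fin 2) ℂ :=
  Matrix.of fun s t => ρ (A.piecewise t s) (A.piecewise s t)

/-- The logarithmic negativity `log₂ tr |ρ^{T_A}|` between `A` and its complement, where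
`|O| = √(O† O)`. -/
def logNegativity (A : Finset E) (ρ : Matrix (E → Fin 2) (E → Fin 2) ℂ) : ℝ :=
  Real.logb 2 (CFC.abs (partialTranspose A ρ)).trace.re

end Qubits

/-! ### The toric code, with one qubit on each edge -/

namespace CombMap

variable {D : Type*} [Finite D] (M : CombMap D)

/-- Operators on `(ℂ²)^{⊗ edges}`. -/
abbrev Op : Type _ := Matrix (M.Edge → Fin 2) (M.Edge → Fin 2) ℂ

/-- The star operator `A_v`. -/
def starOp (v : M.Vertex) : M.Op := xOp (M.legMult v)

/-- The plaquette operator `B_p`. -/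
def plaquette (p : M.Face) : M.Op := zOp (M.bdryMult p)

/-- The toric code Hamiltonian. -/
def hamiltonian (U J : ℝ) : M.Op :=
  -((U : ℂ) • ∑ v, M.starOp v) - (J : ℂ) • ∑ p, M.plaquette p

/-- The loop operator `Wᶻ` of a loop. -/
def zLoop (γ : M.Edge → ZMod 2) : M.Op := zOp fun e => (γ e).val

/-- The loop operator `Wˣ` of a dual loop. -/
def xLoop (δ : M.Edge → ZMod 2) : M.Op := xOp fun e => (δ e).val

/-- The projector `∏_p (1 + B_p) / 2`. -/
def plaquetteProj : M.Op :=
  Finset.univ.noncommProd (fun p => (2 : ℂ)⁻¹ • (1 + M.plaquette p)) (by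
    intro p _ q _ _
    have h : Commute (M.plaquette p) (M.plaquette q) := zOp_commute _ _
    exact ((((Commute.one_left _).add_left (((Commute.one_right _).add_right h))).smul_left
      _).smul_right _))

/-- The four types of anyonic flux. -/
inductive Flux
  | I
  | e
  | m
  | em

/-- The ground state with trivial flux,
`N ∏_p (1 + B_p) / 2 · (1 + Wᶻ₁) / 2 |+⋯+⟩`. -/
def trivialFluxState (W : M.LoopSystem) : (M.Edge → Fin 2) → ℂ :=
  normalized ((M.plaquetteProj * ((2 : ℂ)⁻¹ • (1 + M.zLoop W.z₁))) *ᵥ plusState)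

/-- The ground states with definite flux through the interior of the torus. -/
def fluxState (W : M.LoopSystem) : Flux → ((M.Edge → Fin 2) → ℂ)
  | Flux.I => M.trivialFluxState W
  | Flux.e => M.xLoop W.x₂ *ᵥ M.trivialFluxState W
  | Flux.m => M.zLoop W.z₂ *ᵥ M.trivialFluxState W
  | Flux.em => (M.xLoop W.x₂ * M.zLoop W.z₂) *ᵥ M.trivialFluxState W

instance : Fintype Flux where
  elems := ⟨[Flux.I, Flux.e, Flux.m, Flux.em], by simp⟩
  complete := by intro i; cases i <;> simp

end CombMap

end

/-!
Chains of edges are vectors over `ℤ/2`, and configurations of the qubits in the computational basis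
are such chains `s`. Star operators translate `s` by coboundaries and plaquette operators are signs
given by the flux of `s` through a face, so that every energy eigenvalue exceeds the sum of the
lowest eigenvalues of all terms by an amount that vanishes exactly on the states fixed by all stars
and plaquettes (`CombMap.energy_excess`). These are the functions on dual loops that are invariant
under coboundaries. By the Euler characteristic the first cohomology has dimension `2`
(`CombMap.IsTorus.exists_eq_vecMul_vertexMatrix`), so they are the functions of the two crossing
numbers `z₁ ⬝ᵥ s` and `z₂ ⬝ᵥ s`, and a Fourier transformation in the second one gives the four flux
states: `s` has the amplitude `K (c (a, 0) + c (a, 1) (-1) ^ (z₂ ⬝ᵥ s))` with `a = z₁ ⬝ᵥ s`.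

For the negativity, split `s` into its parts in `A` and in the complement. It is a dual loop exactly
if both parts have the same flux `r` through all faces. Since `z₁` has deformations in both regions,
`z₁ ⬝ᵥ s` is the pairing of `r` with the faces between them. Hence a superposition of flux states is
a sum over the shared fluxes `r` and over `b : ℤ/2` of product vectors with coefficients `c (a, b)`,
which are the characters of `z₂` on the two parts (`CombMap.sum_smul_fluxState_apply_restrict`).
They are orthogonal because either region contains a dual loop that crosses `z₂` oddly: the push-off
of the deformation of `z₁` in it (`CombMap.IsLoop.exists_dual`, `CombMap.IsTorus.exists_dual`). So
this is a Schmidt decomposition, in which the partial transpose is a weighted permutation of pairs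
of Schmidt vectors, and its trace norm is the square of the sum of the Schmidt coefficients
(`CombMap.IsTorus.trace_abs_partialTranspose`).

The shared fluxes `r` are counted by duality. Those with `z₁ ⬝ᵥ s = 0` are the annihilator of the
sets `T` of faces for which the part of the boundary of `T` in `A` is a loop
(`CombMap.IsTorus.mem_sharedFlux_iff`), and this holds if and only if `T` contains all or none of
the faces on each boundary curve (`CombMap.isLoop_restrict_iff`). Hence `r` is supported on the
boundary plaquettes and has sum `0` over each curve, which leaves `2 ^ (n₁ - 1) * 2 ^ (n₂ - 1)`
choices.
-/

noncomputable section

/-! ### Linear algebra -/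

/-- A linear system is solvable if its right-hand side is orthogonal to the left kernel. -/
theorem exists_mulVec_eq_of_forall_vecMul {K m n : Type*} [Field K] [Fintype m] [Fintype n]
    (P : Matrix m n K) (b : m → K) (h : ∀ y, y ᵥ* P = 0 → y ⬝ᵥ b = 0) : ∃ x, P *ᵥ x = b := by
  classical
  by_contra hb
  have hb' : b ∉ LinearMap.range P.mulVecLin := by
    rintro ⟨x, hx⟩
    exact hb ⟨x, hx⟩
  obtain ⟨f, hfb, hf⟩ := Submodule.exists_dual_map_eq_bot_of_notMem hb' inferInstance
  have hfy : ∀ v, f v = (fun i => f (Pi.single i 1)) ⬝ᵥ v := by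
    intro v
    conv_lhs => rw [← Finset.univ_sum_single v, map_sum]
    refine Finset.sum_congr rfl fun i _ => ?_
    rw [mul_comm, ← smul_eq_mul, ← map_smul, ← Pi.single_smul, smul_eq_mul, mul_one]
  refine hfb ?_
  rw [hfy]
  refine h _ ?_
  ext j
  have : f (P *ᵥ Pi.single j 1) = 0 := by
    have h2 : f (P *ᵥ Pi.single j 1) ∈ (LinearMap.range P.mulVecLin).map f :=
      ⟨_, ⟨_, rfl⟩, rfl⟩
    rwa [hf, Submodule.mem_bot] at h2
  rw [hfy, Matrix.dotProduct_mulVec, dotProduct_single, mul_one] at this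
  exact this

theorem ZMod.two_eq_zero_or_one (a : ZMod 2) : a = 0 ∨ a = 1 := by
  revert a; decide

/-- A set that is mapped into itself by a permutation is a union of cycles. -/
theorem Equiv.Perm.SameCycle.of_forall {α : Type*} [Finite α] {σ : Equiv.Perm α} {q : α → Prop}
    (hq : ∀ x, q x → q (σ x)) {x y : α} (h : σ.SameCycle x y) (hx : q x) : q y := by
  obtain ⟨n, rfl⟩ := h.exists_nat_pow_eq
  induction n with
  | zero => simpa using hx
  | succ k ih =>
    rw [pow_succ', Equiv.Perm.mul_apply]
    exact hq _ (ih ⟨k, by simp⟩)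

/-- The points of a cycle that satisfy `q` are consecutive if `q` changes at most twice along the
cycle: a function that is constant along the steps starting in `q` takes a single value on them. -/
theorem Equiv.Perm.SameCycle.eq_of_card_le_two {α β : Type*} [Finite α] {σ : Equiv.Perm α}
    {q : α → Prop} {g : α → β} (hg : ∀ x, q x → g (σ x) = g x) {x y : α} (h : σ.SameCycle x y)
    (hcard : Nat.card {z : α // ¬(q z ↔ q (σ z)) ∧ σ.SameCycle x z} ≤ 2)
    (hx : q x) (hy : q y) : g x = g y := by
  classical
  by_contra hne
  -- along the cycle the set `{q, g = g x}` is left, the set `{q, g = g y}` is left, and the first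
  -- one is entered: three different changes of `q`
  have exit : ∀ u v : α, σ.SameCycle x u → σ.SameCycle u v → q u → q v → g u ≠ g v →
      ∃ z, σ.SameCycle x z ∧ q z ∧ g z = g u ∧ ¬ q (σ z) := by
    intro u v hxu huv hu hv hguv
    by_contra hno
    push Not at hno
    have := huv.of_forall (q := fun z => σ.SameCycle x z ∧ q z ∧ g z = g u)
      (fun z hz => ⟨Equiv.Perm.sameCycle_apply_right.2 hz.1, hno z hz.1 hz.2.1 hz.2.2,
        (hg z hz.2.1).trans hz.2.2⟩) ⟨hxu, hu, Eq.refl _⟩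
    exact hguv this.2.2.symm
  obtain ⟨a, hxa, hqa, hga, hqa'⟩ := exit x y (Equiv.Perm.SameCycle.refl _ _) h hx hy hne
  obtain ⟨b, hxb, hqb, hgb, hqb'⟩ := exit y x h h.symm hy hx (Ne.symm hne)
  have enter : ∃ z, σ.SameCycle x z ∧ ¬ q z ∧ q (σ z) := by
    by_contra hno
    push Not at hno
    have := h.symm.of_forall (q := fun z => σ.SameCycle x z ∧ ¬(q z ∧ g z = g x)) (by
      rintro z ⟨hz, hz'⟩
      refine ⟨Equiv.Perm.sameCycle_apply_right.2 hz, fun hz2 => ?_⟩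
      by_cases hqz : q z
      · exact hz' ⟨hqz, (hg z hqz).symm.trans hz2.2⟩
      · exact hno z hz hqz hz2.1) ⟨h, fun h' => hne h'.2.symm⟩
    exact this.2 ⟨hx, Eq.refl _⟩
  obtain ⟨c, hxc, hqc, hqc'⟩ := enter
  have hab : a ≠ b := fun e => hne (by rw [← hga, e, hgb])
  have hac : a ≠ c := fun e => hqc (e ▸ hqa)
  have hbc : b ≠ c := fun e => hqc (e ▸ hqb)
  have := Fintype.ofFinite {z : α // ¬(q z ↔ q (σ z)) ∧ σ.SameCycle x z}
  rw [Nat.card_eq_fintype_card, ← Finset.card_univ] at hcard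
  have h3 := Finset.card_le_card (Finset.subset_univ
    ({⟨a, fun e => hqa' (e.1 hqa), hxa⟩, ⟨b, fun e => hqb' (e.1 hqb), hxb⟩,
      ⟨c, fun e => hqc (e.2 hqc'), hxc⟩} : Finset {z : α // ¬(q z ↔ q (σ z)) ∧ σ.SameCycle x z}))
  rw [Finset.card_eq_three.2 ⟨_, _, _, by simpa using hab, by simpa using hac,
    by simpa using hbc, Eq.refl _⟩] at h3
  omega

namespace CombMap

/-! ### Chains and darts -/

variable {D : Type*} (M : CombMap D)

theorem edge_rev (d : D) : M.edge (M.rev d) = M.edge d :=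
  Quotient.sound (Equiv.Perm.sameCycle_apply_left.2 (Equiv.Perm.SameCycle.refl _ _))

theorem vertex_rot (d : D) : M.vertex (M.rot d) = M.vertex d :=
  Quotient.sound (Equiv.Perm.sameCycle_apply_left.2 (Equiv.Perm.SameCycle.refl _ _))

theorem face_rot_rev (d : D) : M.face (M.rot (M.rev d)) = M.face d :=
  Quotient.sound (s := Equiv.Perm.SameCycle.setoid (M.rot * M.rev))
    (Equiv.Perm.sameCycle_apply_left (f := M.rot * M.rev).2 (Equiv.Perm.SameCycle.refl _ _))

theorem face_rev (d : D) : M.face (M.rev d) = M.cornerFace d := by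
  rw [cornerFace, ← M.face_rot_rev (M.rev d), M.rev_rev]

theorem vertex_eq_iff {d d' : D} : M.vertex d = M.vertex d' ↔ M.rot.SameCycle d d' :=
  ⟨fun h => Quotient.exact h, fun h => Quotient.sound h⟩

theorem exists_edge (e : M.Edge) : ∃ d, M.edge d = e := Quotient.exists_rep e

theorem exists_vertex (v : M.Vertex) : ∃ d, M.vertex d = v := Quotient.exists_rep v

theorem exists_face (p : M.Face) : ∃ d, M.face d = p := Quotient.exists_rep p

variable [Fintype D]

theorem edge_eq_iff {d d' : D} : M.edge d = M.edge d' ↔ d' = d ∨ d' = M.rev d := by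
  refine ⟨fun h => ?_, ?_⟩
  · have h' : M.rev.SameCycle d d' := Quotient.exact h
    refine h'.of_forall (q := fun x => x = d ∨ x = M.rev d) ?_ (Or.inl rfl)
    rintro x (rfl | rfl)
    · exact Or.inr rfl
    · exact Or.inl (M.rev_rev _)
  · rintro (rfl | rfl)
    · rfl
    · exact (M.edge_rev _).symm

section Mult

variable {X : Type*} [DecidableEq X] (π : D → X)

/-- A sum over edges that counts multiplicities is a sum over darts. -/
theorem sum_mult_mul (x : X) (g : M.Edge → ZMod 2) :
    ∑ e, ((Nat.card {d : D // π d = x ∧ M.edge d = e} : ℕ) : ZMod 2) * g e =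
      ∑ d with π d = x, g (M.edge d) := by
  classical
  rw [← Finset.sum_fiberwise _ M.edge]
  refine Finset.sum_congr rfl fun e _ => ?_
  rw [Finset.sum_congr rfl (g := fun _ => g e) (by
    intro d hd
    rw [(Finset.mem_filter.1 hd).2]), Finset.sum_const, nsmul_eq_mul, Finset.filter_filter,
    Nat.card_eq_fintype_card, Fintype.card_subtype]

variable [Fintype X]

theorem sum_mul_mult (f : X → ZMod 2) (d : D) :
    ∑ x, f x * ((Nat.card {d' : D // π d' = x ∧ M.edge d' = M.edge d} : ℕ) : ZMod 2) =
      f (π d) + f (π (M.rev d)) := by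
  classical
  have h : (Finset.univ.filter fun d' => M.edge d' = M.edge d) = {d, M.rev d} := by
    ext d'
    simp only [Finset.mem_filter, Finset.mem_univ, true_and, Finset.mem_insert,
      Finset.mem_singleton]
    rw [eq_comm, M.edge_eq_iff]
  rw [← Finset.sum_pair (f := fun d => f (π d)) (M.rev_ne d).symm, ← h,
    ← Finset.sum_fiberwise _ π]
  refine Finset.sum_congr rfl fun x _ => ?_
  rw [Finset.sum_congr rfl (s₁ := Finset.filter _ _) (g := fun _ => f x) (by
    intro d hd
    rw [(Finset.mem_filter.1 hd).2]), Finset.sum_const, nsmul_eq_mul, Finset.filter_filter,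
    Nat.card_eq_fintype_card, Fintype.card_subtype, mul_comm]
  simp only [and_comm]

end Mult

/-- The incidence matrix of vertices and edges, mod 2: multiplication by a column vector is the
boundary map of chains of edges, multiplication by a row vector is the coboundary map. -/
def vertexMatrix : Matrix M.Vertex M.Edge (ZMod 2) := Matrix.of fun v e => (M.legMult v e : ZMod 2)

/-- The incidence matrix of faces and edges, mod 2: multiplication by a row vector is the boundary
map of chains of faces, multiplication by a column vector is the flux through the faces. -/
def faceMatrix : Matrix M.Face M.Edge (ZMod 2) := Matrix.of fun p e => (M.bdryMult p e : ZMod 2)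

theorem vertexMatrix_mulVec (g : M.Edge → ZMod 2) (v : M.Vertex) :
    (M.vertexMatrix *ᵥ g) v = ∑ d with M.vertex d = v, g (M.edge d) := M.sum_mult_mul M.vertex v g

theorem faceMatrix_mulVec (g : M.Edge → ZMod 2) (p : M.Face) :
    (M.faceMatrix *ᵥ g) p = ∑ d with M.face d = p, g (M.edge d) := M.sum_mult_mul M.face p g

theorem vecMul_vertexMatrix (f : M.Vertex → ZMod 2) (d : D) :
    (f ᵥ* M.vertexMatrix) (M.edge d) = f (M.vertex d) + f (M.vertex (M.rev d)) :=
  M.sum_mul_mult M.vertex f d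

theorem vecMul_faceMatrix (T : M.Face → ZMod 2) (d : D) :
    (T ᵥ* M.faceMatrix) (M.edge d) = T (M.face d) + T (M.face (M.rev d)) :=
  M.sum_mul_mult M.face T d

theorem isLoop_iff (γ : M.Edge → ZMod 2) : M.IsLoop γ ↔ M.vertexMatrix *ᵥ γ = 0 :=
  funext_iff.symm

theorem isDualLoop_iff (δ : M.Edge → ZMod 2) : M.IsDualLoop δ ↔ M.faceMatrix *ᵥ δ = 0 :=
  funext_iff.symm

theorem homologous_iff (γ γ' : M.Edge → ZMod 2) :
    M.Homologous γ γ' ↔ ∃ T, γ' = γ + T ᵥ* M.faceMatrix :=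
  exists_congr fun _ => funext_iff.symm

theorem sum_vertex_rot (v : M.Vertex) (h : D → ZMod 2) :
    ∑ d with M.vertex d = v, h (M.rot d) = ∑ d with M.vertex d = v, h d := by
  refine Finset.sum_equiv M.rot (fun d => ?_) fun _ _ => rfl
  simp [M.vertex_rot]

theorem sum_face_rot_rev (p : M.Face) (h : D → ZMod 2) :
    ∑ d with M.face d = p, h (M.rot (M.rev d)) = ∑ d with M.face d = p, h d := by
  refine Finset.sum_equiv (M.rot * M.rev) (fun d => ?_) fun _ _ => rfl
  simp [M.face_rot_rev]

/-- A coboundary is a cocycle. -/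
theorem faceMatrix_mulVec_vecMul (f : M.Vertex → ZMod 2) :
    M.faceMatrix *ᵥ (f ᵥ* M.vertexMatrix) = 0 := by
  ext p
  rw [faceMatrix_mulVec]
  simp only [vecMul_vertexMatrix, Pi.zero_apply]
  have h := M.sum_face_rot_rev p fun d => f (M.vertex d)
  simp only [M.vertex_rot] at h
  rw [Finset.sum_add_distrib, h, CharTwo.add_self_eq_zero]

theorem dotProduct_vecMul_vertexMatrix {γ : M.Edge → ZMod 2} (hγ : M.IsLoop γ)
    (f : M.Vertex → ZMod 2) : γ ⬝ᵥ (f ᵥ* M.vertexMatrix) = 0 := by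
  rw [dotProduct_comm, ← Matrix.dotProduct_mulVec, (M.isLoop_iff _).1 hγ, dotProduct_zero]

theorem exists_comp_vertex {h : D → ZMod 2} (hh : ∀ d, h (M.rot d) = h d) :
    ∃ f : M.Vertex → ZMod 2, ∀ d, f (M.vertex d) = h d :=
  ⟨Quotient.lift h fun a _ hab =>
    (Equiv.Perm.SameCycle.of_forall (q := fun x => h a = h x) (fun x hx => by rw [hx, hh]) hab rfl),
    fun _ => rfl⟩

theorem exists_comp_face {h : D → ZMod 2} (hh : ∀ d, h (M.rot (M.rev d)) = h d) :
    ∃ f : M.Face → ZMod 2, ∀ d, f (M.face d) = h d :=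
  ⟨Quotient.lift h fun a _ hab =>
    (Equiv.Perm.SameCycle.of_forall (σ := M.rot * M.rev) (q := fun x => h a = h x)
      (fun x hx => by rw [hx, Equiv.Perm.mul_apply, hh]) hab rfl),
    fun _ => rfl⟩

end CombMap

namespace CombMap

/-! ### Cohomology of the torus -/

variable {D : Type*} (M : CombMap D)

variable {M} in
theorem IsTorus.eq_of_invariant (hM : M.IsTorus) {β : Type*} {h : D → β}
    (h₁ : ∀ d, h (M.rot d) = h d) (h₂ : ∀ d, h (M.rev d) = h d) (d d' : D) : h d = h d' := by
  obtain ⟨g, hg, rfl⟩ := hM.connected d d'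
  induction hg using Subgroup.closure_induction generalizing d with
  | mem x hx =>
    rcases hx with rfl | rfl
    · exact (h₁ d).symm
    · exact (h₂ d).symm
  | one => rfl
  | mul x y _ _ hx hy => rw [Equiv.Perm.mul_apply, ← hx, ← hy]
  | inv x _ hx => simpa using (hx (x⁻¹ d)).symm

variable [Fintype D]

/-- The rank of an incidence matrix whose left kernel consists of the constants. -/
theorem finrank_range_vecMulLinear {X Y : Type*} [Fintype X] [Nonempty X] [Fintype Y]
    (P : Matrix X Y (ZMod 2)) (h : ∀ T, T ᵥ* P = 0 ↔ ∀ x y, T x = T y) :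
    Module.finrank (ZMod 2) (LinearMap.range P.vecMulLinear) + 1 = Fintype.card X := by
  have hker : LinearMap.ker P.vecMulLinear = Submodule.span (ZMod 2) {1} := by
    ext T
    rw [LinearMap.mem_ker, Matrix.vecMulLinear_apply, h, Submodule.mem_span_singleton]
    constructor
    · intro hT
      obtain ⟨x⟩ := ‹Nonempty X›
      refine ⟨T x, funext fun y => ?_⟩
      simpa using hT x y
    · rintro ⟨a, rfl⟩ x y
      rfl
  rw [← Module.finrank_fintype_fun_eq_card (ZMod 2) (η := X),
    ← LinearMap.finrank_range_add_finrank_ker P.vecMulLinear, hker, finrank_span_singleton]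
  exact one_ne_zero

variable {M} in
theorem IsTorus.vecMul_vertexMatrix_eq_zero_iff (hM : M.IsTorus) (f : M.Vertex → ZMod 2) :
    f ᵥ* M.vertexMatrix = 0 ↔ ∀ v w, f v = f w := by
  constructor
  · intro h v w
    obtain ⟨d, rfl⟩ := M.exists_vertex v
    obtain ⟨d', rfl⟩ := M.exists_vertex w
    refine hM.eq_of_invariant (h := fun d => f (M.vertex d)) (fun d => ?_) (fun d => ?_) d d'
    · simp only [M.vertex_rot]
    · exact (CharTwo.add_eq_zero.1 ((M.vecMul_vertexMatrix f d).symm.trans (congrFun h _))).symm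
  · intro h
    ext e
    obtain ⟨d, rfl⟩ := M.exists_edge e
    rw [vecMul_vertexMatrix, h (M.vertex (M.rev d)), CharTwo.add_self_eq_zero]
    rfl

variable {M} in
theorem IsTorus.vecMul_faceMatrix_eq_zero_iff (hM : M.IsTorus) (T : M.Face → ZMod 2) :
    T ᵥ* M.faceMatrix = 0 ↔ ∀ p q, T p = T q := by
  constructor
  · intro h p q
    obtain ⟨d, rfl⟩ := M.exists_face p
    obtain ⟨d', rfl⟩ := M.exists_face q
    have hrev : ∀ d, T (M.face (M.rev d)) = T (M.face d) := fun d =>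
      (CharTwo.add_eq_zero.1 ((M.vecMul_faceMatrix T d).symm.trans (congrFun h _))).symm
    refine hM.eq_of_invariant (h := fun d => T (M.face d)) (fun d => ?_) hrev d d'
    have := M.face_rot_rev (M.rev d)
    rw [M.rev_rev] at this
    simp only [this, hrev]
  · intro h
    ext e
    obtain ⟨d, rfl⟩ := M.exists_edge e
    rw [vecMul_faceMatrix, h (M.face (M.rev d)), CharTwo.add_self_eq_zero]
    rfl

namespace LoopSystem

variable {M} (W : M.LoopSystem)

theorem dotProduct_z₁_x₁ : W.z₁ ⬝ᵥ W.x₁ = 0 := W.cross₁₁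
theorem dotProduct_z₁_x₂ : W.z₁ ⬝ᵥ W.x₂ = 1 := W.cross₁₂
theorem dotProduct_z₂_x₁ : W.z₂ ⬝ᵥ W.x₁ = 1 := W.cross₂₁
theorem dotProduct_z₂_x₂ : W.z₂ ⬝ᵥ W.x₂ = 0 := W.cross₂₂

include W in
theorem nonempty : Nonempty D := by
  by_contra hD
  rw [not_nonempty_iff] at hD
  have : IsEmpty M.Edge := ⟨fun e => hD.elim (M.exists_edge e).choose⟩
  have h := W.dotProduct_z₁_x₂
  rw [dotProduct, Finset.univ_eq_empty, Finset.sum_empty] at h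
  exact zero_ne_one h

end LoopSystem

variable {M} in
/-- The first cohomology of the torus has dimension `2`, so that a dual loop is a coboundary as
soon as it crosses `z₁` and `z₂` evenly. -/
theorem IsTorus.exists_eq_vecMul_vertexMatrix (hM : M.IsTorus) (W : M.LoopSystem)
    {s : M.Edge → ZMod 2} (hs : M.faceMatrix *ᵥ s = 0) (h₁ : W.z₁ ⬝ᵥ s = 0)
    (h₂ : W.z₂ ⬝ᵥ s = 0) : ∃ f : M.Vertex → ZMod 2, s = f ᵥ* M.vertexMatrix := by
  obtain ⟨d₀⟩ := W.nonempty
  have : Nonempty M.Vertex := ⟨M.vertex d₀⟩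
  have : Nonempty M.Face := ⟨M.face d₀⟩
  have hV := finrank_range_vecMulLinear _ hM.vecMul_vertexMatrix_eq_zero_iff
  have hF := finrank_range_vecMulLinear _ hM.vecMul_faceMatrix_eq_zero_iff
  set B := LinearMap.range M.vertexMatrix.vecMulLinear with hB
  set Z := LinearMap.ker M.faceMatrix.mulVecLin with hZ
  have hZE : Module.finrank (ZMod 2) Z + Fintype.card M.Face = Fintype.card M.Edge + 1 := by
    have h := LinearMap.finrank_range_add_finrank_ker M.faceMatrix.mulVecLin
    rw [Module.finrank_fintype_fun_eq_card, ← hZ] at h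
    have h' : Module.finrank (ZMod 2) (LinearMap.range M.faceMatrix.mulVecLin) =
        Module.finrank (ZMod 2) (LinearMap.range M.faceMatrix.vecMulLinear) := by
      have := M.faceMatrix.rank_transpose
      rw [Matrix.rank, Matrix.rank, Matrix.mulVecLin_transpose] at this
      exact this.symm
    omega
  have hE := hM.euler
  simp only [Nat.card_eq_fintype_card] at hE
  have hBZ : B ≤ Z := by
    rintro _ ⟨f, rfl⟩
    exact M.faceMatrix_mulVec_vecMul f
  let Φ : (M.Edge → ZMod 2) →ₗ[ZMod 2] ZMod 2 × ZMod 2 :=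
    LinearMap.prod (dotProductBilin (ZMod 2) (ZMod 2) W.z₁)
      (dotProductBilin (ZMod 2) (ZMod 2) W.z₂)
  have hΦ : ∀ t, Φ t = (W.z₁ ⬝ᵥ t, W.z₂ ⬝ᵥ t) := fun t => rfl
  have hsurj : Function.Surjective (Φ.domRestrict Z) := by
    rintro ⟨a, b⟩
    refine ⟨⟨a • W.x₂ + b • W.x₁, Z.add_mem (Z.smul_mem _ ((M.isDualLoop_iff _).1 W.dual₂))
      (Z.smul_mem _ ((M.isDualLoop_iff _).1 W.dual₁))⟩, ?_⟩
    simp only [LinearMap.domRestrict_apply, hΦ, dotProduct_add, dotProduct_smul,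
      W.dotProduct_z₁_x₁, W.dotProduct_z₁_x₂, W.dotProduct_z₂_x₁, W.dotProduct_z₂_x₂]
    simp
  have hrank := LinearMap.finrank_range_add_finrank_ker (Φ.domRestrict Z)
  rw [LinearMap.range_eq_top.2 hsurj, finrank_top, Module.finrank_prod, Module.finrank_self]
    at hrank
  have hle : B.comap Z.subtype ≤ LinearMap.ker (Φ.domRestrict Z) := by
    rintro ⟨t, ht⟩ ⟨f, hf⟩
    rw [LinearMap.mem_ker, LinearMap.domRestrict_apply, hΦ]
    change M.vertexMatrix.vecMulLinear f = t at hf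
    subst hf
    simp only [Matrix.vecMulLinear_apply, M.dotProduct_vecMul_vertexMatrix W.loop₁,
      M.dotProduct_vecMul_vertexMatrix W.loop₂]
    rfl
  have heq := Submodule.eq_of_le_of_finrank_eq hle (by
    rw [(Submodule.comapSubtypeEquivOfLe hBZ).finrank_eq]
    omega)
  have hmem : (⟨s, hs⟩ : Z) ∈ LinearMap.ker (Φ.domRestrict Z) := by
    rw [LinearMap.mem_ker, LinearMap.domRestrict_apply, hΦ, h₁, h₂]
    rfl
  rw [← heq] at hmem
  obtain ⟨f, hf⟩ := hmem
  exact ⟨f, hf.symm⟩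

variable {M} in
/-- A dual loop is orthogonal to a loop if it crosses `z₁` and `z₂` evenly. -/
theorem IsTorus.dotProduct_eq_zero (hM : M.IsTorus) (W : M.LoopSystem)
    {s : M.Edge → ZMod 2} (hs : M.faceMatrix *ᵥ s = 0) (h₁ : W.z₁ ⬝ᵥ s = 0)
    (h₂ : W.z₂ ⬝ᵥ s = 0) {γ : M.Edge → ZMod 2} (hγ : M.IsLoop γ) : γ ⬝ᵥ s = 0 := by
  obtain ⟨f, rfl⟩ := hM.exists_eq_vecMul_vertexMatrix W hs h₁ h₂
  exact M.dotProduct_vecMul_vertexMatrix hγ f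

/-! ### Pushing a loop off to a dual loop -/

variable {M} in
/-- A loop `γ` in a region `A` whose boundary passes at most once through each vertex can be pushed
off to a dual loop in `A`. It crosses the edge of a dart `d` with the parity
`c d + c (rev d) + γ (edge d)`, where the potential `c d` counts the darts of `γ` that are passed on
the way to `d` around its vertex, starting in the complement of `A` if this has edges there. If the
dual loop is a coboundary then `γ` is a boundary. -/
theorem IsLoop.exists_dual {γ : M.Edge → ZMod 2} (hγ : M.IsLoop γ) {A : Finset M.Edge}
    (hγA : ∀ e, γ e ≠ 0 → e ∈ A)
    (hA : ∀ v, Nat.card {d : D // M.IsCut A d ∧ M.vertex d = v} ≤ 2) :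
    ∃ δ : M.Edge → ZMod 2, M.faceMatrix *ᵥ δ = 0 ∧ (∀ e, δ e ≠ 0 → e ∈ A) ∧
      ∀ f : M.Vertex → ZMod 2, δ = f ᵥ* M.vertexMatrix →
        ∃ T : M.Face → ZMod 2, γ = T ᵥ* M.faceMatrix := by
  classical
  -- a potential exists because `γ` has an even number of darts at each vertex
  obtain ⟨c₀, hc₀⟩ : ∃ c : D → ZMod 2, ∀ d, c (M.rot d) = c d + γ (M.edge d) := by
    let P : Matrix D D (ZMod 2) := Matrix.of fun d d' =>
      (if d' = M.rot d then 1 else 0) + (if d' = d then 1 else 0)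
    have hP : ∀ c d, (P *ᵥ c) d = c (M.rot d) + c d := by
      intro c d
      simp [P, Matrix.mulVec, dotProduct, add_mul, Finset.sum_add_distrib]
    have hP' : ∀ y d, (y ᵥ* P) (M.rot d) = y d + y (M.rot d) := by
      intro y d
      simp [P, Matrix.vecMul, dotProduct, mul_add, Finset.sum_add_distrib]
    obtain ⟨c, hc⟩ := exists_mulVec_eq_of_forall_vecMul P (fun d => γ (M.edge d)) (by
      intro y hy
      obtain ⟨f, hf⟩ := M.exists_comp_vertex (h := y) fun d =>
        (CharTwo.add_eq_zero.1 ((hP' y d).symm.trans (congrFun hy _))).symm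
      rw [dotProduct, ← Finset.sum_fiberwise _ M.vertex]
      refine Finset.sum_eq_zero fun v _ => ?_
      rw [Finset.sum_congr rfl (g := fun d => f v * γ (M.edge d)) (by
        intro d hd
        rw [← hf, (Finset.mem_filter.1 hd).2]), ← Finset.mul_sum, ← vertexMatrix_mulVec,
        (M.isLoop_iff _).1 hγ, Pi.zero_apply, mul_zero])
    refine ⟨c, fun d => ?_⟩
    rw [← congrFun hc d, hP, add_left_comm, CharTwo.add_self_eq_zero, add_zero]
  -- it is constant on the darts at a vertex that are outside `A`, and can be made `0` there
  have hconst : ∀ d d', M.vertex d = M.vertex d' → M.edge d ∉ A → M.edge d' ∉ A →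
      c₀ d = c₀ d' := by
    intro d d' hdd hd hd'
    refine ((M.vertex_eq_iff).1 hdd).eq_of_card_le_two (q := fun x => M.edge x ∉ A)
      (fun x hx => ?_) ?_ hd hd'
    · rw [hc₀, by_contra fun h => hx (hγA _ h), add_zero]
    · refine le_trans (le_of_eq (Nat.card_congr (Equiv.subtypeEquivRight fun z => ?_)))
        (hA (M.vertex d))
      rw [IsCut, eq_comm (b := M.vertex d), M.vertex_eq_iff, not_iff_not]
  let b : M.Vertex → ZMod 2 := fun v =>
    if h : ∃ d, M.vertex d = v ∧ M.edge d ∉ A then c₀ h.choose else 0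
  let c : D → ZMod 2 := fun d => c₀ d + b (M.vertex d)
  have hc : ∀ d, c (M.rot d) = c d + γ (M.edge d) := by
    intro d
    simp only [c, hc₀, M.vertex_rot]
    ring
  have hcA : ∀ d, M.edge d ∉ A → c d = 0 := by
    intro d hd
    have h : ∃ d', M.vertex d' = M.vertex d ∧ M.edge d' ∉ A := ⟨d, rfl, hd⟩
    simp only [c, b, dif_pos h]
    rw [hconst _ _ h.choose_spec.1 h.choose_spec.2 hd, CharTwo.add_self_eq_zero]
  let δ : M.Edge → ZMod 2 := fun e =>
    c (M.exists_edge e).choose + c (M.rev (M.exists_edge e).choose) + γ e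
  have hδ : ∀ d, δ (M.edge d) = c d + c (M.rev d) + γ (M.edge d) := by
    intro d
    simp only [δ]
    rcases M.edge_eq_iff.1 (M.exists_edge (M.edge d)).choose_spec.symm with h | h
    · rw [h]
    · rw [h, M.rev_rev, add_comm (c (M.rev d))]
  refine ⟨δ, ?_, ?_, ?_⟩
  · ext p
    rw [faceMatrix_mulVec, Pi.zero_apply]
    have h := M.sum_face_rot_rev p c
    simp only [hc, M.edge_rev] at h
    simp only [hδ, add_assoc]
    rw [Finset.sum_add_distrib, h, CharTwo.add_self_eq_zero]
  · intro e he
    by_contra heA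
    obtain ⟨d, rfl⟩ := M.exists_edge e
    refine he ?_
    rw [hδ, hcA _ heA, hcA _ (by rwa [M.edge_rev]), by_contra fun h => heA (hγA _ h)]
    simp
  · intro f hf
    -- the potential `c + f` is constant along the faces, which `γ` separates
    have key : ∀ d, c (M.rev d) + f (M.vertex (M.rev d)) =
        c d + f (M.vertex d) + γ (M.edge d) := by
      intro d
      have h := (hδ d).symm.trans ((congrFun hf _).trans (M.vecMul_vertexMatrix f d))
      linear_combination (exp := 1) h - (c d + γ (M.edge d)) * CharTwo.two_eq_zero (R := ZMod 2) +
        (f (M.vertex (M.rev d))) * CharTwo.two_eq_zero (R := ZMod 2)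
    obtain ⟨T, hT⟩ := M.exists_comp_face (h := fun d => c d + f (M.vertex d)) (by
      intro d
      have h := key (M.rev d)
      rw [M.rev_rev] at h
      simp only [hc, M.vertex_rot]
      rw [h]
      ring)
    refine ⟨T, ?_⟩
    ext e
    obtain ⟨d, rfl⟩ := M.exists_edge e
    rw [vecMul_faceMatrix, hT, hT, key, ← add_assoc, CharTwo.add_self_eq_zero, zero_add]

end CombMap

/-! ### Restriction of chains to a region -/

theorem add_self_eq_zero_of_zmod_two {X : Type*} (s : X → ZMod 2) : s + s = 0 :=
  funext fun _ => CharTwo.add_self_eq_zero _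

theorem add_eq_zero_iff_of_zmod_two {X : Type*} {s t : X → ZMod 2} : s + t = 0 ↔ s = t := by
  simp only [funext_iff, Pi.add_apply, Pi.zero_apply, CharTwo.add_eq_zero]

section Restrict

variable {E : Type*} [DecidableEq E]

/-- The part of a chain that lies in the region `A`. -/
def restrict (A : Finset E) : (E → ZMod 2) →ₗ[ZMod 2] (E → ZMod 2) where
  toFun s e := if e ∈ A then s e else 0
  map_add' s t := by
    ext e
    by_cases h : e ∈ A <;> simp [h]
  map_smul' a s := by
    ext e
    by_cases h : e ∈ A <;> simp [h]

theorem restrict_apply (A : Finset E) (s : E → ZMod 2) (e : E) :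
    restrict A s e = if e ∈ A then s e else 0 := rfl

theorem restrict_eq_self {A : Finset E} {s : E → ZMod 2} (h : ∀ e, s e ≠ 0 → e ∈ A) :
    restrict A s = s := by
  ext e
  by_cases he : e ∈ A
  · simp [restrict_apply, he]
  · simp [restrict_apply, he, by_contra fun h' => he (h e h')]

theorem restrict_ne_zero {A : Finset E} {s : E → ZMod 2} (e : E) (h : restrict A s e ≠ 0) :
    e ∈ A := by
  by_contra he
  exact h (by simp [restrict_apply, he])

theorem restrict_restrict (A : Finset E) (s : E → ZMod 2) :
    restrict A (restrict A s) = restrict A s := restrict_eq_self restrict_ne_zero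

variable [Fintype E]

theorem restrict_add_restrict_compl (A : Finset E) (s : E → ZMod 2) :
    restrict A s + restrict Aᶜ s = s := by
  ext e
  by_cases h : e ∈ A <;> simp [restrict_apply, h]

theorem restrict_dotProduct (A : Finset E) (s t : E → ZMod 2) :
    restrict A s ⬝ᵥ t = s ⬝ᵥ restrict A t := by
  refine Finset.sum_congr rfl fun e _ => ?_
  by_cases h : e ∈ A <;> simp [restrict_apply, h]

theorem restrict_compl_eq_zero {A : Finset E} {s : E → ZMod 2} (h : ∀ e, s e ≠ 0 → e ∈ A) :
    restrict Aᶜ s = 0 := by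
  have := restrict_add_restrict_compl A s
  rw [restrict_eq_self h] at this
  simpa using this

theorem restrict_compl_restrict (A : Finset E) (s : E → ZMod 2) :
    restrict Aᶜ (restrict A s) = 0 := restrict_compl_eq_zero restrict_ne_zero

theorem restrict_restrict_compl (A : Finset E) (s : E → ZMod 2) :
    restrict A (restrict Aᶜ s) = 0 := by
  simpa using restrict_compl_restrict Aᶜ s

end Restrict

namespace CombMap

variable {D : Type*} (M : CombMap D)

theorem isCut_compl [Fintype D] (A : Finset M.Edge) (d : D) : M.IsCut Aᶜ d ↔ M.IsCut A d := by
  simp only [IsCut, Finset.mem_compl, not_iff_not]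

variable [Fintype D]

theorem WindsAlong.exists_loop {M : CombMap D} {A : Finset M.Edge} {γ : M.Edge → ZMod 2}
    (h : M.WindsAlong A γ) : ∃ γ', (∃ T, γ' = γ + T ᵥ* M.faceMatrix) ∧ ∀ e, γ' e ≠ 0 → e ∈ A := by
  obtain ⟨γ', h₁, h₂⟩ := h
  exact ⟨γ', (M.homologous_iff _ _).1 h₁, h₂⟩

theorem vertexMatrix_mulVec_vecMul (T : M.Face → ZMod 2) :
    M.vertexMatrix *ᵥ (T ᵥ* M.faceMatrix) = 0 := by
  refine dotProduct_eq_zero _ fun f => ?_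
  rw [dotProduct_comm, Matrix.dotProduct_mulVec, dotProduct_comm, ← Matrix.dotProduct_mulVec,
    faceMatrix_mulVec_vecMul, dotProduct_zero]

/-! ### Dual loops within the regions -/

variable {M} in
/-- If both `A` and its complement wind around the torus in direction `1`, then so does a dual loop
within `A`. It does not cross `z₁`, which can be deformed into the complement of `A`. -/
theorem IsTorus.exists_dual (hM : M.IsTorus) (W : M.LoopSystem) {A : Finset M.Edge}
    (hA : M.WindsAlong A W.z₁) (hB : M.WindsAlong Aᶜ W.z₁)
    (hcut : ∀ v, Nat.card {d : D // M.IsCut A d ∧ M.vertex d = v} ≤ 2) :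
    ∃ δ : M.Edge → ZMod 2, M.faceMatrix *ᵥ δ = 0 ∧ (∀ e, δ e ≠ 0 → e ∈ A) ∧
      W.z₁ ⬝ᵥ δ = 0 ∧ W.z₂ ⬝ᵥ δ = 1 := by
  obtain ⟨γ, ⟨T, hT⟩, hγ⟩ := hA.exists_loop
  obtain ⟨γ', ⟨T', hT'⟩, hγ'⟩ := hB.exists_loop
  have hloop : M.IsLoop γ := by
    rw [isLoop_iff, hT, Matrix.mulVec_add, (M.isLoop_iff _).1 W.loop₁,
      vertexMatrix_mulVec_vecMul, add_zero]
  obtain ⟨δ, hδ, hδA, hex⟩ := hloop.exists_dual hγ hcut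
  have h₁ : W.z₁ ⬝ᵥ δ = 0 := by
    have h : γ' ⬝ᵥ δ = 0 := by
      rw [← restrict_eq_self hγ', restrict_dotProduct, restrict_compl_eq_zero hδA,
        dotProduct_zero]
    rwa [hT', add_dotProduct, ← Matrix.dotProduct_mulVec, hδ, dotProduct_zero, add_zero] at h
  refine ⟨δ, hδ, hδA, h₁, (ZMod.two_eq_zero_or_one _).resolve_left fun h₂ => ?_⟩
  obtain ⟨f, hf⟩ := hM.exists_eq_vecMul_vertexMatrix W hδ h₁ h₂
  obtain ⟨T'', hT''⟩ := hex f hf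
  have hx := (M.isDualLoop_iff _).1 W.dual₂
  have h := congrArg (· ⬝ᵥ W.x₂) (hT.symm.trans hT'')
  simp only [add_dotProduct, ← Matrix.dotProduct_mulVec, hx, dotProduct_zero, add_zero,
    W.dotProduct_z₁_x₂] at h
  exact one_ne_zero h

/-! ### Boundary curves -/

open Classical in
/-- The part in `A` of the boundary of a set of faces has an end at a vertex for each crossed corner
there that lies in one of the faces. -/
theorem vertexMatrix_mulVec_restrict (A : Finset M.Edge) (T : M.Face → ZMod 2) (v : M.Vertex) :
    (M.vertexMatrix *ᵥ restrict A (T ᵥ* M.faceMatrix)) v =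
      ∑ d with M.IsCut A d ∧ M.vertex d = v, T (M.cornerFace d) := by
  have h := M.sum_vertex_rot v fun d => if M.edge d ∈ A then T (M.face d) else 0
  rw [vertexMatrix_mulVec]
  simp only [restrict_apply, vecMul_faceMatrix, M.face_rev]
  rw [Finset.sum_congr rfl (g := fun d => (if M.edge d ∈ A then T (M.face d) else 0) +
    (if M.edge d ∈ A then T (M.cornerFace d) else 0)) (by intro d _; split_ifs <;> simp),
    Finset.sum_add_distrib, ← h, ← Finset.sum_add_distrib]
  simp only [and_comm (a := M.IsCut A _)]
  rw [← Finset.filter_filter, Finset.sum_filter (M.IsCut A)]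
  refine Finset.sum_congr rfl fun d _ => ?_
  change (if M.edge (M.rot d) ∈ A then T (M.cornerFace d) else 0) + _ = _
  unfold IsCut
  by_cases h₁ : M.edge d ∈ A <;> by_cases h₂ : M.edge (M.rot d) ∈ A <;>
    simp [h₁, h₂, CharTwo.add_self_eq_zero]

/-- The boundary curve that passes through a crossed corner. -/
def curveOf {A : Finset M.Edge} (c : {d : D // M.IsCut A d}) : M.Boundary A := Quotient.mk _ c

/-- The set of faces with indicator `T` contains all or none of the plaquettes spanning each
boundary curve of `A`. -/
def IsCurvewise (A : Finset M.Edge) (T : M.Face → ZMod 2) : Prop :=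
  ∀ c c' : {d : D // M.IsCut A d}, M.curveOf c = M.curveOf c' →
    T (M.cornerFace c.1) = T (M.cornerFace c'.1)

/-- The part in `A` of the boundary of `T` is closed if and only if each boundary curve of `A`,
which crosses `0` or `2` corners at a vertex, stays in `T` or outside `T` when it passes a vertex. -/
theorem isLoop_restrict_iff {A : Finset M.Edge}
    (hcut : ∀ v, Nat.card {d : D // M.IsCut A d ∧ M.vertex d = v} ≤ 2) (T : M.Face → ZMod 2) :
    M.IsLoop (restrict A (T ᵥ* M.faceMatrix)) ↔ M.IsCurvewise A T := by
  classical
  rw [isLoop_iff]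
  have hcard : ∀ v, (Finset.univ.filter fun d => M.IsCut A d ∧ M.vertex d = v).card ≤ 2 := by
    intro v
    have := hcut v
    rwa [Nat.card_eq_fintype_card, Fintype.card_subtype] at this
  constructor
  · intro h c c' hcc
    have hcc' : Relation.EqvGen _ c c' := Quotient.exact hcc
    induction hcc' with
    | rel c c' hr =>
      rcases hr with hr | hr
      · by_cases hne : c = c'
        · rw [hne]
        · have hv := congrFun h (M.vertex c.1)
          have hsub : {c.1, c'.1} ⊆
              Finset.univ.filter fun d => M.IsCut A d ∧ M.vertex d = M.vertex c.1 := by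
            intro d hd
            rcases Finset.mem_insert.1 hd with rfl | hd
            · simpa using c.2
            · rw [Finset.mem_singleton.1 hd]
              simpa [hr] using c'.2
          have hne' : c.1 ≠ c'.1 := fun e => hne (Subtype.ext e)
          rw [vertexMatrix_mulVec_restrict, ← Finset.eq_of_subset_of_card_le hsub
            ((hcard _).trans (Finset.card_pair hne').ge), Finset.sum_pair hne'] at hv
          exact CharTwo.add_eq_zero.1 hv
      · rw [hr]
    | refl c => rfl
    | symm c c' _ ih => exact (ih (Quotient.sound ‹_›)).symm
    | trans c c' c'' _ _ ih₁ ih₂ =>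
      exact (ih₁ (Quotient.sound ‹_›)).trans (ih₂ (Quotient.sound ‹_›))
  · intro h
    ext v
    rw [vertexMatrix_mulVec_restrict, Pi.zero_apply]
    -- the number of crossed corners at `v` is even, as the sum of all faces has no boundary
    have heven :
        ((Finset.univ.filter fun d => M.IsCut A d ∧ M.vertex d = v).card : ZMod 2) = 0 := by
      have h1 : (1 : M.Face → ZMod 2) ᵥ* M.faceMatrix = 0 := by
        ext e
        obtain ⟨d, rfl⟩ := M.exists_edge e
        rw [vecMul_faceMatrix]
        exact CharTwo.add_self_eq_zero _
      have := M.vertexMatrix_mulVec_restrict A 1 v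
      rw [h1, map_zero, Matrix.mulVec_zero] at this
      simpa using this.symm
    rcases Finset.eq_empty_or_nonempty
      (Finset.univ.filter fun d => M.IsCut A d ∧ M.vertex d = v) with he | ⟨d, hd⟩
    · rw [he, Finset.sum_empty]
    · rw [Finset.sum_congr rfl (g := fun _ => T (M.cornerFace d)), Finset.sum_const, nsmul_eq_mul,
        heven, zero_mul]
      intro d' hd'
      simp only [Finset.mem_filter, Finset.mem_univ, true_and] at hd hd'
      exact h ⟨d', hd'.1⟩ ⟨d, hd.1⟩ (Quotient.sound (Relation.EqvGen.rel _ _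
        (Or.inl (hd'.2.trans hd.2.symm))))

/-! ### Fluxes through the plaquettes on the boundary -/

/-- The flux of the part of a chain of edges in the region `A` through the faces. -/
def regionFlux (A : Finset M.Edge) : (M.Edge → ZMod 2) →ₗ[ZMod 2] (M.Face → ZMod 2) :=
  M.faceMatrix.mulVecLin ∘ₗ restrict A

theorem regionFlux_apply (A : Finset M.Edge) (s : M.Edge → ZMod 2) :
    M.regionFlux A s = M.faceMatrix *ᵥ restrict A s := rfl

theorem regionFlux_add_compl (A : Finset M.Edge) (s : M.Edge → ZMod 2) :
    M.regionFlux A s + M.regionFlux Aᶜ s = M.faceMatrix *ᵥ s := by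
  rw [regionFlux_apply, regionFlux_apply, ← Matrix.mulVec_add, restrict_add_restrict_compl]

theorem faceMatrix_mulVec_eq_zero_iff (A : Finset M.Edge) (s : M.Edge → ZMod 2) :
    M.faceMatrix *ᵥ s = 0 ↔ M.regionFlux A s = M.regionFlux Aᶜ s := by
  rw [← M.regionFlux_add_compl A]
  exact add_eq_zero_iff_of_zmod_two

theorem dotProduct_regionFlux (A : Finset M.Edge) (T : M.Face → ZMod 2) (s : M.Edge → ZMod 2) :
    T ⬝ᵥ M.regionFlux A s = restrict A (T ᵥ* M.faceMatrix) ⬝ᵥ s := by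
  rw [regionFlux_apply, Matrix.dotProduct_mulVec, restrict_dotProduct]

/-- The fluxes on which the two regions can agree. They label the sectors of the Schmidt
decomposition of a ground state. -/
def sharedFlux (A : Finset M.Edge) : Submodule (ZMod 2) (M.Face → ZMod 2) :=
  LinearMap.range (M.regionFlux A) ⊓ LinearMap.range (M.regionFlux Aᶜ)

theorem exists_regionFlux_eq {A : Finset M.Edge} {r : M.Face → ZMod 2}
    (h : ∀ T, restrict A (T ᵥ* M.faceMatrix) = 0 → T ⬝ᵥ r = 0) : ∃ s, M.regionFlux A s = r := by
  obtain ⟨s, hs⟩ := exists_mulVec_eq_of_forall_vecMul (LinearMap.toMatrix' (M.regionFlux A)) r (by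
    intro T hT
    refine h T (dotProduct_eq_zero _ fun s => ?_)
    rw [← dotProduct_regionFlux, ← LinearMap.toMatrix'_mulVec, Matrix.dotProduct_mulVec, hT,
      zero_dotProduct])
  exact ⟨s, by rwa [LinearMap.toMatrix'_mulVec] at hs⟩

theorem exists_of_mem_sharedFlux {A : Finset M.Edge} {r r' : M.Face → ZMod 2}
    (hr : r ∈ M.sharedFlux A) (hr' : r' ∈ M.sharedFlux A) :
    ∃ s, M.regionFlux A s = r ∧ M.regionFlux Aᶜ s = r' := by
  obtain ⟨⟨a, ha⟩, -⟩ := hr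
  obtain ⟨-, ⟨b, hb⟩⟩ := hr'
  refine ⟨restrict A a + restrict Aᶜ b, ?_, ?_⟩
  · rw [regionFlux_apply, map_add, restrict_restrict, restrict_restrict_compl, add_zero, ← ha]
    rfl
  · rw [regionFlux_apply, map_add, restrict_restrict, restrict_compl_restrict, zero_add, ← hb]
    rfl

variable {M} in
/-- The crossings of a dual loop with `γ` can be read off from the flux of its part in `A` through
the faces `T` between a deformation of `γ` in `A` and one in the complement of `A`. -/
theorem exists_dotProduct_regionFlux_eq {γ : M.Edge → ZMod 2} {A : Finset M.Edge}
    (hA : M.WindsAlong A γ) (hB : M.WindsAlong Aᶜ γ) (hγ : M.IsLoop γ) :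
    ∃ T, M.IsLoop (restrict A (T ᵥ* M.faceMatrix)) ∧
      ∀ s, M.faceMatrix *ᵥ s = 0 → T ⬝ᵥ M.regionFlux A s = γ ⬝ᵥ s := by
  obtain ⟨α, ⟨T₁, h₁⟩, hα⟩ := hA.exists_loop
  obtain ⟨β, ⟨T₂, h₂⟩, hβ⟩ := hB.exists_loop
  have h : restrict A ((T₁ + T₂) ᵥ* M.faceMatrix) = α := by
    have h' : (T₁ + T₂) ᵥ* M.faceMatrix = α + β := by
      rw [Matrix.add_vecMul, h₁, h₂, add_add_add_comm, add_self_eq_zero_of_zmod_two, zero_add]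
    have hβ' := restrict_compl_eq_zero hβ
    rw [compl_compl] at hβ'
    rw [h', map_add, restrict_eq_self hα, hβ', add_zero]
  refine ⟨T₁ + T₂, ?_, fun s hs => ?_⟩
  · rw [h, isLoop_iff, h₁, Matrix.mulVec_add, (M.isLoop_iff _).1 hγ, vertexMatrix_mulVec_vecMul,
      add_zero]
  · rw [dotProduct_regionFlux, h, h₁, add_dotProduct, ← Matrix.dotProduct_mulVec, hs,
      dotProduct_zero, add_zero]

variable {M} in
/-- The shared fluxes of dual loops that cross `z₁` evenly are those with sum `0` over every set of
faces that contains all or none of the plaquettes on each boundary curve. -/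
theorem IsTorus.mem_sharedFlux_iff (hM : M.IsTorus) (W : M.LoopSystem) {A : Finset M.Edge}
    (hA : M.WindsAlong A W.z₁) (hB : M.WindsAlong Aᶜ W.z₁)
    (hcut : ∀ v, Nat.card {d : D // M.IsCut A d ∧ M.vertex d = v} ≤ 2) {T₀ : M.Face → ZMod 2}
    (hT₀ : M.IsLoop (restrict A (T₀ ᵥ* M.faceMatrix)))
    (hT₀' : ∀ s, M.faceMatrix *ᵥ s = 0 → T₀ ⬝ᵥ M.regionFlux A s = W.z₁ ⬝ᵥ s)
    (r : M.Face → ZMod 2) :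
    r ∈ M.sharedFlux A ∧ T₀ ⬝ᵥ r = 0 ↔ ∀ T, M.IsCurvewise A T → T ⬝ᵥ r = 0 := by
  constructor
  · rintro ⟨hr, hr₀⟩ T hT
    obtain ⟨s, hs, hs'⟩ := M.exists_of_mem_sharedFlux hr hr
    have hss : M.faceMatrix *ᵥ s = 0 := (M.faceMatrix_mulVec_eq_zero_iff A s).2 (hs.trans hs'.symm)
    rw [← hs, hT₀' s hss] at hr₀
    obtain ⟨δ, hδ, hδB, hδ₁, hδ₂⟩ := hM.exists_dual W hB (by rwa [compl_compl])
      (by simpa only [isCut_compl] using hcut)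
    -- up to coboundaries `s` is a multiple of a dual loop in the complement of `A`
    have hγ := (M.isLoop_restrict_iff hcut T).2 hT
    have h := hM.dotProduct_eq_zero W (s := s + (W.z₂ ⬝ᵥ s) • δ)
      (by rw [Matrix.mulVec_add, Matrix.mulVec_smul, hss, hδ, smul_zero, add_zero])
      (by rw [dotProduct_add, dotProduct_smul, hr₀, hδ₁, smul_zero, add_zero])
      (by rw [dotProduct_add, dotProduct_smul, hδ₂, smul_eq_mul, mul_one,
        CharTwo.add_self_eq_zero]) hγ
    have hδA := restrict_compl_eq_zero hδB
    rw [compl_compl] at hδA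
    rw [dotProduct_add, dotProduct_smul, restrict_dotProduct _ _ δ, hδA, dotProduct_zero,
      smul_zero, add_zero] at h
    rw [← hs, dotProduct_regionFlux, h]
  · intro h
    have h₀ := h T₀ ((M.isLoop_restrict_iff hcut T₀).1 hT₀)
    refine ⟨⟨M.exists_regionFlux_eq fun T hT => h T ?_, M.exists_regionFlux_eq fun T hT => h T ?_⟩,
      h₀⟩
    · rw [← M.isLoop_restrict_iff hcut, hT, isLoop_iff, Matrix.mulVec_zero]
    · have h' := restrict_add_restrict_compl A (T ᵥ* M.faceMatrix)
      rw [hT, add_zero] at h'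
      rw [← M.isLoop_restrict_iff hcut, h', isLoop_iff, vertexMatrix_mulVec_vecMul]

end CombMap

/-! ### Counting shared fluxes -/

/-- The number of functions on `F₁ ∪ F₂`, extended by `0`, that have sum `0` over `F₁` and over
`F₂`. -/
theorem card_sum_eq_zero {X : Type*} [Fintype X] [DecidableEq X] {F₁ F₂ : Finset X}
    (hd : Disjoint F₁ F₂) (h₁ : F₁.Nonempty) (h₂ : F₂.Nonempty) :
    Nat.card {r : X → ZMod 2 // (∀ p, p ∉ F₁ → p ∉ F₂ → r p = 0) ∧ ∑ p ∈ F₁, r p = 0 ∧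
      ∑ p ∈ F₂, r p = 0} = 2 ^ (F₁.card - 1) * 2 ^ (F₂.card - 1) := by
  let Λ : (X → ZMod 2) →ₗ[ZMod 2] ({p : X // p ∉ F₁ ∪ F₂} → ZMod 2) × ZMod 2 × ZMod 2 :=
    { toFun := fun r => (fun p => r p.1, ∑ p ∈ F₁, r p, ∑ p ∈ F₂, r p)
      map_add' := fun r s => by
        simp only [Pi.add_apply, Finset.sum_add_distrib]
        rfl
      map_smul' := fun a r => by
        simp only [Pi.smul_apply, ← Finset.smul_sum]
        rfl }
  have hΛ : ∀ r, Λ r = (fun p => r p.1, ∑ p ∈ F₁, r p, ∑ p ∈ F₂, r p) := fun r => rfl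
  have hker : Nat.card {r : X → ZMod 2 // (∀ p, p ∉ F₁ → p ∉ F₂ → r p = 0) ∧
      ∑ p ∈ F₁, r p = 0 ∧ ∑ p ∈ F₂, r p = 0} = Nat.card (LinearMap.ker Λ) := by
    refine Nat.card_congr (Equiv.subtypeEquivRight fun r => ?_)
    rw [LinearMap.mem_ker, hΛ, Prod.mk_eq_zero, Prod.mk_eq_zero, funext_iff]
    simp only [Subtype.forall, Finset.mem_union, not_or, and_imp, Pi.zero_apply]
  obtain ⟨p₁, hp₁⟩ := h₁
  obtain ⟨p₂, hp₂⟩ := h₂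
  have hsurj : Function.Surjective Λ := by
    rintro ⟨u, a, b⟩
    refine ⟨fun p => if h : p ∉ F₁ ∪ F₂ then u ⟨p, h⟩ else
      (if p = p₁ then a else 0) + if p = p₂ then b else 0, ?_⟩
    have hp₁' : p₁ ∉ F₂ := Finset.disjoint_left.1 hd hp₁
    have hp₂' : p₂ ∉ F₁ := Finset.disjoint_right.1 hd hp₂
    rw [hΛ, Prod.mk.injEq, Prod.mk.injEq]
    refine ⟨funext fun p => by rw [dif_pos p.2], ?_, ?_⟩
    · rw [Finset.sum_congr rfl (g := fun p => (if p = p₁ then a else 0) + if p = p₂ then b else 0)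
        (fun p hp => by rw [dif_neg (not_not.2 (Finset.mem_union_left _ hp))])]
      simp [Finset.sum_add_distrib, hp₁, hp₂']
    · rw [Finset.sum_congr rfl (g := fun p => (if p = p₁ then a else 0) + if p = p₂ then b else 0)
        (fun p hp => by rw [dif_neg (not_not.2 (Finset.mem_union_right _ hp))])]
      simp [Finset.sum_add_distrib, hp₂, hp₁']
  have hrank := LinearMap.finrank_range_add_finrank_ker Λ
  rw [LinearMap.range_eq_top.2 hsurj, finrank_top, Module.finrank_prod, Module.finrank_prod,
    Module.finrank_self, Module.finrank_fintype_fun_eq_card, Module.finrank_fintype_fun_eq_card,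
    Fintype.card_subtype_compl, Fintype.card_coe, Finset.card_union_of_disjoint hd] at hrank
  have hle : F₁.card + F₂.card ≤ Fintype.card X := by
    rw [← Finset.card_union_of_disjoint hd]
    exact Finset.card_le_univ _
  have hc₁ := Finset.card_pos.2 ⟨p₁, hp₁⟩
  have hc₂ := Finset.card_pos.2 ⟨p₂, hp₂⟩
  rw [hker, Module.natCard_eq_pow_finrank (K := ZMod 2), Nat.card_zmod, ← pow_add]
  congr 1
  omega

namespace CombMap

variable {D : Type*} (M : CombMap D) [Fintype D]

open Classical in
/-- The plaquettes spanning a boundary curve. -/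
def curveFaces (A : Finset M.Edge) (Γ : M.Boundary A) : Finset M.Face :=
  Finset.univ.filter fun p => ∃ c : {d : D // M.IsCut A d},
    M.curveOf c = Γ ∧ M.cornerFace c.1 = p

theorem card_curveFaces (A : Finset M.Edge) (Γ : M.Boundary A) :
    (M.curveFaces A Γ).card = M.numPlaquettes A Γ := by
  classical
  exact ((Nat.card_eq_fintype_card).trans (Fintype.card_subtype fun p =>
    ∃ c : {d : D // M.IsCut A d}, M.curveOf c = Γ ∧ M.cornerFace c.1 = p)).symm

variable {M} {A : Finset M.Edge}

theorem cornerFace_mem_curveFaces {c : {d : D // M.IsCut A d}} {Γ : M.Boundary A} :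
    M.cornerFace c.1 ∈ M.curveFaces A Γ ↔ M.curveOf c = Γ := by
  simp only [curveFaces, Finset.mem_filter, Finset.mem_univ, true_and]
  constructor
  · rintro ⟨c', rfl, h⟩
    exact Quotient.sound (Relation.EqvGen.rel _ _ (Or.inr h.symm))
  · intro h
    exact ⟨c, h, rfl⟩

theorem curveFaces_nonempty (Γ : M.Boundary A) : (M.curveFaces A Γ).Nonempty := by
  obtain ⟨c, rfl⟩ := Quotient.exists_rep Γ
  exact ⟨_, cornerFace_mem_curveFaces.2 rfl⟩

theorem exists_of_mem_curveFaces {Γ : M.Boundary A} {p : M.Face} (hp : p ∈ M.curveFaces A Γ) :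
    ∃ c : {d : D // M.IsCut A d}, M.curveOf c = Γ ∧ M.cornerFace c.1 = p := by
  simpa only [curveFaces, Finset.mem_filter, Finset.mem_univ, true_and] using hp

theorem disjoint_curveFaces {Γ₁ Γ₂ : M.Boundary A} (hne : Γ₁ ≠ Γ₂) :
    Disjoint (M.curveFaces A Γ₁) (M.curveFaces A Γ₂) := by
  refine Finset.disjoint_left.2 fun p hp hp' => hne ?_
  obtain ⟨c, rfl, rfl⟩ := exists_of_mem_curveFaces hp
  exact cornerFace_mem_curveFaces.1 hp'

theorem numPlaquettes_pos (Γ : M.Boundary A) : 0 < M.numPlaquettes A Γ := by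
  rw [← M.card_curveFaces]
  exact (curveFaces_nonempty Γ).card_pos

/-- Orthogonality to all unions of curves and single faces off the curves, made explicit. -/
theorem forall_isCurvewise_iff {Γ₁ Γ₂ : M.Boundary A} (hne : Γ₁ ≠ Γ₂)
    (htwo : ∀ Γ : M.Boundary A, Γ = Γ₁ ∨ Γ = Γ₂) (r : M.Face → ZMod 2) :
    (∀ T, M.IsCurvewise A T → T ⬝ᵥ r = 0) ↔
      (∀ p, p ∉ M.curveFaces A Γ₁ → p ∉ M.curveFaces A Γ₂ → r p = 0) ∧
        ∑ p ∈ M.curveFaces A Γ₁, r p = 0 ∧ ∑ p ∈ M.curveFaces A Γ₂, r p = 0 := by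
  have hd := disjoint_curveFaces hne
  constructor
  · intro h
    have hsum : ∀ Γ, ∑ p ∈ M.curveFaces A Γ, r p = 0 := by
      intro Γ
      rw [← h (fun p => if p ∈ M.curveFaces A Γ then 1 else 0)]
      · simp [dotProduct]
      · intro c c' hcc
        have : M.cornerFace c.1 ∈ M.curveFaces A Γ ↔ M.cornerFace c'.1 ∈ M.curveFaces A Γ := by
          rw [cornerFace_mem_curveFaces, hcc, cornerFace_mem_curveFaces]
        simp only [this]
    refine ⟨fun p hp₁ hp₂ => ?_, hsum _, hsum _⟩
    rw [← h (Pi.single p 1)]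
    · simp
    · intro c c' _
      have hc : ∀ c : {d : D // M.IsCut A d}, M.cornerFace c.1 ≠ p := by
        rintro c rfl
        rcases htwo (M.curveOf c) with h' | h'
        · exact hp₁ (cornerFace_mem_curveFaces.2 h')
        · exact hp₂ (cornerFace_mem_curveFaces.2 h')
      rw [Pi.single_eq_of_ne (hc c), Pi.single_eq_of_ne (hc c')]
  · rintro ⟨h₀, h₁, h₂⟩ T hT
    have hsum : ∀ Γ, ∑ p ∈ M.curveFaces A Γ, r p = 0 →
        ∑ p ∈ M.curveFaces A Γ, T p * r p = 0 := by
      intro Γ hΓ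
      obtain ⟨p₀, hp₀⟩ := curveFaces_nonempty Γ
      obtain ⟨c₀, hc₀, rfl⟩ := exists_of_mem_curveFaces hp₀
      rw [Finset.sum_congr rfl (g := fun p => T (M.cornerFace c₀.1) * r p), ← Finset.mul_sum, hΓ,
        mul_zero]
      intro p hp
      obtain ⟨c, hc, rfl⟩ := exists_of_mem_curveFaces hp
      rw [hT c c₀ (hc.trans hc₀.symm)]
    rw [dotProduct, ← Finset.sum_subset (Finset.subset_univ
      (M.curveFaces A Γ₁ ∪ M.curveFaces A Γ₂)), Finset.sum_union hd, hsum _ h₁, hsum _ h₂, add_zero]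
    intro p _ hp
    rw [Finset.mem_union, not_or] at hp
    rw [h₀ p hp.1 hp.2, mul_zero]

instance : Fintype (M.sharedFlux A) := Fintype.ofFinite _

/-- Half of the shared fluxes belong to dual loops that cross `z₁` evenly, half to those that cross
it oddly, such as `x₂`. -/
theorem IsTorus.card_sharedFlux (hM : M.IsTorus) (W : M.LoopSystem)
    (hA : M.WindsAlong A W.z₁) (hB : M.WindsAlong Aᶜ W.z₁)
    (hcut : ∀ v, Nat.card {d : D // M.IsCut A d ∧ M.vertex d = v} ≤ 2)
    {Γ₁ Γ₂ : M.Boundary A} (hne : Γ₁ ≠ Γ₂) (htwo : ∀ Γ : M.Boundary A, Γ = Γ₁ ∨ Γ = Γ₂)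
    {T₀ : M.Face → ZMod 2} (hT₀ : M.IsLoop (restrict A (T₀ ᵥ* M.faceMatrix)))
    (hT₀' : ∀ s, M.faceMatrix *ᵥ s = 0 → T₀ ⬝ᵥ M.regionFlux A s = W.z₁ ⬝ᵥ s) (a : ZMod 2) :
    (Finset.univ.filter fun r : M.sharedFlux A => T₀ ⬝ᵥ (r : M.Face → ZMod 2) = a).card =
      2 ^ (M.numPlaquettes A Γ₁ - 1) * 2 ^ (M.numPlaquettes A Γ₂ - 1) := by
  classical
  let φ : M.sharedFlux A →+ ZMod 2 :=
    ((dotProductBilin (ZMod 2) (ZMod 2) T₀).domRestrict (M.sharedFlux A)).toAddMonoidHom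
  have hφ : ∀ r, φ r = T₀ ⬝ᵥ (r : M.Face → ZMod 2) := fun r => rfl
  have hx := (M.isDualLoop_iff _).1 W.dual₂
  have hsurj : ∀ a, a ∈ Set.range φ := by
    intro a
    rcases ZMod.two_eq_zero_or_one a with rfl | rfl
    · exact ⟨0, map_zero φ⟩
    · refine ⟨⟨M.regionFlux A W.x₂, ⟨_, rfl⟩, ⟨W.x₂, ?_⟩⟩, ?_⟩
      · exact ((M.faceMatrix_mulVec_eq_zero_iff A _).1 hx).symm
      · rw [hφ, hT₀' _ hx, W.dotProduct_z₁_x₂]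
  have h := AddMonoidHom.card_fiber_eq_of_mem_range φ (hsurj a) (hsurj 0)
  simp only [hφ] at h
  rw [h, ← M.card_curveFaces, ← M.card_curveFaces,
    ← card_sum_eq_zero (disjoint_curveFaces hne) (curveFaces_nonempty _) (curveFaces_nonempty _),
    ← Fintype.card_subtype, ← Nat.card_eq_fintype_card]
  refine Nat.card_congr ((Equiv.subtypeSubtypeEquivSubtypeInter (fun r => r ∈ M.sharedFlux A)
    (fun r => T₀ ⬝ᵥ r = 0)).trans (Equiv.subtypeEquivRight fun r => ?_))
  rw [← forall_isCurvewise_iff hne htwo, ← hM.mem_sharedFlux_iff W hA hB hcut hT₀ hT₀']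

end CombMap

/-! ### Pauli operators in the computational basis -/

section Pauli

/-- The nontrivial character of `ℤ/2`. -/
def sgn (a : ZMod 2) : ℂ := if a = 0 then 1 else -1

theorem sgn_zero : sgn 0 = 1 := if_pos rfl

theorem sgn_one : sgn 1 = -1 := if_neg (by decide)

theorem sgn_add (a b : ZMod 2) : sgn (a + b) = sgn a * sgn b := by
  rcases ZMod.two_eq_zero_or_one a with rfl | rfl <;>
    rcases ZMod.two_eq_zero_or_one b with rfl | rfl <;>
    simp [sgn_zero, sgn_one, CharTwo.add_self_eq_zero]

theorem star_sgn (a : ZMod 2) : star (sgn a) = sgn a := by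
  rcases ZMod.two_eq_zero_or_one a with rfl | rfl <;> simp [sgn_zero, sgn_one]

theorem norm_sgn (a : ZMod 2) : ‖sgn a‖ = 1 := by
  rcases ZMod.two_eq_zero_or_one a with rfl | rfl <;> simp [sgn_zero, sgn_one]

theorem sgn_sum {ι : Type*} (s : Finset ι) (f : ι → ZMod 2) :
    sgn (∑ i ∈ s, f i) = ∏ i ∈ s, sgn (f i) := by
  classical
  induction s using Finset.induction_on with
  | empty => exact sgn_zero
  | insert i s hi ih => rw [Finset.sum_insert hi, Finset.prod_insert hi, sgn_add, ih]

theorem sum_zmod_two {R : Type*} [AddCommMonoid R] (f : ZMod 2 → R) : ∑ a, f a = f 0 + f 1 :=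
  Fin.sum_univ_two f

theorem pauliX_mul_self : pauliX * pauliX = 1 := by
  ext i j
  fin_cases i <;> fin_cases j <;> simp [pauliX, Matrix.mul_apply]

theorem pauliZ_mul_self : pauliZ * pauliZ = 1 := by
  ext i j
  fin_cases i <;> fin_cases j <;> simp [pauliZ, Matrix.mul_apply]

theorem pow_eq_of_mul_self {R : Type*} [Monoid R] {x : R} (hx : x * x = 1) (k : ℕ) :
    x ^ k = if (k : ZMod 2) = 0 then 1 else x := by
  rcases Nat.even_or_odd' k with ⟨m, rfl | rfl⟩
  · rw [pow_mul, sq, hx, one_pow, if_pos]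
    rw [ZMod.natCast_eq_zero_iff]
    exact dvd_mul_right _ _
  · rw [pow_succ, pow_mul, sq, hx, one_pow, one_mul, if_neg]
    rw [ZMod.natCast_eq_zero_iff]
    omega

theorem pauliX_pow_apply (k : ℕ) (a b : ZMod 2) :
    (pauliX ^ k) a b = if b = a + (k : ZMod 2) then 1 else 0 := by
  rw [pow_eq_of_mul_self pauliX_mul_self]
  generalize (k : ZMod 2) = c
  rcases ZMod.two_eq_zero_or_one c with rfl | rfl
  · simp only [if_true, add_zero]
    exact (Matrix.one_apply (i := (a : Fin 2)) (j := b)).trans (if_congr eq_comm rfl rfl)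
  · rcases ZMod.two_eq_zero_or_one a with rfl | rfl <;>
      rcases ZMod.two_eq_zero_or_one b with rfl | rfl <;>
      simp [pauliX, CharTwo.add_self_eq_zero] <;> rfl

theorem pauliZ_pow_apply (k : ℕ) (a b : ZMod 2) :
    (pauliZ ^ k) a b = if a = b then sgn (k * a) else 0 := by
  rw [pow_eq_of_mul_self pauliZ_mul_self]
  generalize (k : ZMod 2) = c
  rcases ZMod.two_eq_zero_or_one c with rfl | rfl
  · simp only [if_true, zero_mul, sgn_zero]
    exact Matrix.one_apply (i := (a : Fin 2)) (j := b)
  · rcases ZMod.two_eq_zero_or_one a with rfl | rfl <;>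
      rcases ZMod.two_eq_zero_or_one b with rfl | rfl <;>
      simp [pauliZ, sgn_zero, sgn_one] <;> rfl

/-- Configurations of the qubits as chains mod 2. The types are definitionally equal; the explicit
equivalence keeps the arithmetic of `ZMod 2` apart from the indices in `Fin 2`. -/
def bits {E : Type*} : (E → ZMod 2) ≃ (E → Fin 2) := Equiv.refl _

theorem eq_of_forall_bits {E β : Type*} {f g : (E → Fin 2) → β} (h : ∀ s, f (bits s) = g (bits s)) :
    f = g :=
  funext fun s => by simpa using h (bits.symm s)

variable {E : Type*} [Fintype E] [DecidableEq E]

theorem sum_bits {R : Type*} [AddCommMonoid R] (f : (E → Fin 2) → R) :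
    ∑ s, f s = ∑ s : E → ZMod 2, f (bits s) := (Equiv.sum_comp bits f).symm

theorem xOp_mulVec (k : E → ℕ) (ψ : (E → Fin 2) → ℂ) (s : E → ZMod 2) :
    (xOp k *ᵥ ψ) (bits s) = ψ (bits (s + fun e => (k e : ZMod 2))) := by
  have h : ∀ t : E → ZMod 2, xOp k (bits s) (bits t) =
      if t = s + fun e => (k e : ZMod 2) then 1 else 0 := by
    intro t
    have h' : xOp k (bits s) (bits t) = ∏ e, if t e = s e + (k e : ZMod 2) then (1 : ℂ) else 0 :=
      Finset.prod_congr rfl fun e _ => pauliX_pow_apply (k e) (s e) (t e)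
    rw [h', Finset.prod_ite_zero, Finset.prod_const_one]
    simp only [funext_iff, Finset.mem_univ, true_imp_iff, Pi.add_apply]
  rw [Matrix.mulVec, dotProduct, sum_bits]
  simp [h]

theorem zOp_mulVec (k : E → ℕ) (ψ : (E → Fin 2) → ℂ) (s : E → ZMod 2) :
    (zOp k *ᵥ ψ) (bits s) = sgn (∑ e, (k e : ZMod 2) * s e) * ψ (bits s) := by
  have h : ∀ t : E → ZMod 2, zOp k (bits s) (bits t) =
      if s = t then sgn (∑ e, (k e : ZMod 2) * s e) else 0 := by
    intro t
    have h' : zOp k (bits s) (bits t) = ∏ e, if s e = t e then sgn ((k e : ZMod 2) * s e) else 0 :=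
      Finset.prod_congr rfl fun e _ => pauliZ_pow_apply (k e) (s e) (t e)
    rw [h', Finset.prod_ite_zero, sgn_sum]
    simp only [funext_iff, Finset.mem_univ, true_imp_iff]
  rw [Matrix.mulVec, dotProduct, sum_bits]
  simp [h]

theorem stateNorm_sq (ψ : (E → Fin 2) → ℂ) : stateNorm ψ ^ 2 = ∑ s, ‖ψ s‖ ^ 2 :=
  Real.sq_sqrt (Finset.sum_nonneg fun _ _ => sq_nonneg _)

end Pauli

namespace CombMap

variable {D : Type*} (M : CombMap D) [Fintype D]

theorem starOp_mulVec (v : M.Vertex) (ψ : (M.Edge → Fin 2) → ℂ) (s : M.Edge → ZMod 2) :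
    (M.starOp v *ᵥ ψ) (bits s) = ψ (bits (s + M.vertexMatrix v)) := xOp_mulVec _ _ _

theorem plaquette_mulVec (p : M.Face) (ψ : (M.Edge → Fin 2) → ℂ) (s : M.Edge → ZMod 2) :
    (M.plaquette p *ᵥ ψ) (bits s) = sgn ((M.faceMatrix *ᵥ s) p) * ψ (bits s) := zOp_mulVec _ _ _

theorem xLoop_mulVec (δ : M.Edge → ZMod 2) (ψ : (M.Edge → Fin 2) → ℂ) (s : M.Edge → ZMod 2) :
    (M.xLoop δ *ᵥ ψ) (bits s) = ψ (bits (s + δ)) := by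
  rw [xLoop, xOp_mulVec]
  simp only [ZMod.natCast_zmod_val]

theorem zLoop_mulVec (γ : M.Edge → ZMod 2) (ψ : (M.Edge → Fin 2) → ℂ) (s : M.Edge → ZMod 2) :
    (M.zLoop γ *ᵥ ψ) (bits s) = sgn (γ ⬝ᵥ s) * ψ (bits s) := by
  rw [zLoop, zOp_mulVec]
  simp only [ZMod.natCast_zmod_val, dotProduct]

theorem half_one_add_sgn (a : ZMod 2) : (2 : ℂ)⁻¹ * (1 + sgn a) = if a = 0 then 1 else 0 := by
  rcases ZMod.two_eq_zero_or_one a with rfl | rfl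
  · rw [sgn_zero, if_pos rfl]
    norm_num
  · rw [sgn_one, if_neg one_ne_zero]
    norm_num

theorem plaquetteProj_mulVec (ψ : (M.Edge → Fin 2) → ℂ) (s : M.Edge → ZMod 2) :
    (M.plaquetteProj *ᵥ ψ) (bits s) = if M.faceMatrix *ᵥ s = 0 then ψ (bits s) else 0 := by
  have key : ∀ (S : Finset M.Face) (comm) (ψ : (M.Edge → Fin 2) → ℂ),
      (S.noncommProd (fun p => (2 : ℂ)⁻¹ • (1 + M.plaquette p)) comm *ᵥ ψ) (bits s) =
        (∏ p ∈ S, if (M.faceMatrix *ᵥ s) p = 0 then 1 else 0) * ψ (bits s) := by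
    intro S
    induction S using Finset.induction_on with
    | empty =>
      intro _ ψ
      rw [Finset.noncommProd_empty, Finset.prod_empty, Matrix.one_mulVec, one_mul]
    | insert p S hp ih =>
      intro comm ψ
      rw [Finset.noncommProd_insert_of_notMem' _ _ _ _ hp, ← Matrix.mulVec_mulVec, ih,
        Finset.prod_insert hp, Matrix.smul_mulVec, Matrix.add_mulVec, Matrix.one_mulVec,
        Pi.smul_apply, Pi.add_apply, plaquette_mulVec, smul_eq_mul, ← half_one_add_sgn]
      ring
  refine (key Finset.univ _ ψ).trans ?_
  rw [Finset.prod_ite_zero, Finset.prod_const_one]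
  simp only [funext_iff, Finset.mem_univ, true_imp_iff, Pi.zero_apply, ite_mul, one_mul, zero_mul]

/-! ### The ground states with definite flux -/

variable {M} (W : M.LoopSystem)

/-- The number of configurations in the support of the trivial flux state. -/
def LoopSystem.supportCard : ℕ :=
  (Finset.univ.filter fun s : M.Edge → ZMod 2 => M.faceMatrix *ᵥ s = 0 ∧ W.z₁ ⬝ᵥ s = 0).card

theorem LoopSystem.supportCard_pos : 0 < W.supportCard :=
  Finset.card_pos.2 ⟨0, by simp⟩

/-- The amplitude of the trivial flux state on its support. -/
def LoopSystem.amplitude : ℝ := (√(W.supportCard : ℝ))⁻¹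

theorem LoopSystem.amplitude_pos : 0 < W.amplitude :=
  inv_pos.2 (Real.sqrt_pos.2 (Nat.cast_pos.2 W.supportCard_pos))

theorem LoopSystem.amplitude_sq : W.amplitude ^ 2 * W.supportCard = 1 := by
  have h := W.supportCard_pos
  rw [amplitude, inv_pow, Real.sq_sqrt (Nat.cast_nonneg _), inv_mul_cancel₀]
  exact_mod_cast h.ne'

theorem trivialFluxState_apply (s : M.Edge → ZMod 2) :
    M.trivialFluxState W (bits s) =
      if M.faceMatrix *ᵥ s = 0 ∧ W.z₁ ⬝ᵥ s = 0 then (W.amplitude : ℂ) else 0 := by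
  set k : ℝ := ∏ _e : M.Edge, (√2 : ℝ)⁻¹ with hk
  have hk0 : 0 < k := Finset.prod_pos fun _ _ => by positivity
  set φ := (M.plaquetteProj * ((2 : ℂ)⁻¹ • (1 + M.zLoop W.z₁))) *ᵥ plusState with hφ
  have hφs : ∀ s, φ (bits s) =
      if M.faceMatrix *ᵥ s = 0 ∧ W.z₁ ⬝ᵥ s = 0 then (k : ℂ) else 0 := by
    intro s
    have hplus : ∀ t, (plusState : (M.Edge → Fin 2) → ℂ) t = k := by
      intro t
      rw [hk, plusState]
      push_cast
      rfl
    rw [hφ, ← Matrix.mulVec_mulVec, plaquetteProj_mulVec, Matrix.smul_mulVec, Matrix.add_mulVec,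
      Matrix.one_mulVec, Pi.smul_apply, Pi.add_apply, zLoop_mulVec, hplus, smul_eq_mul,
      ← one_add_mul, ← mul_assoc, half_one_add_sgn]
    by_cases h₁ : M.faceMatrix *ᵥ s = 0 <;> by_cases h₂ : W.z₁ ⬝ᵥ s = 0 <;> simp [h₁, h₂]
  have hnorm : stateNorm φ = √(W.supportCard : ℝ) * k := by
    rw [stateNorm, sum_bits]
    simp only [hφs, apply_ite norm, norm_zero, Complex.norm_real, ite_pow, Real.norm_eq_abs, sq_abs]
    rw [zero_pow two_ne_zero, ← Finset.sum_filter, Finset.sum_const, nsmul_eq_mul,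
      Real.sqrt_mul (Nat.cast_nonneg _), Real.sqrt_sq hk0.le]
    rfl
  rw [trivialFluxState, ← hφ, normalized, Pi.smul_apply, hφs, hnorm, smul_eq_mul, mul_ite, mul_zero,
    LoopSystem.amplitude]
  congr 1
  have : (k : ℂ) ≠ 0 := by exact_mod_cast hk0.ne'
  push_cast
  rw [mul_inv, mul_assoc, inv_mul_cancel₀ this, mul_one]

/-- The flux types labelled by the charges that `Wˣ₂` and `Wᶻ₂` add. -/
def fluxOf (a b : ZMod 2) : Flux :=
  if a = 0 then (if b = 0 then Flux.I else Flux.m) else (if b = 0 then Flux.e else Flux.em)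

theorem sum_flux {R : Type*} [AddCommMonoid R] (f : Flux → R) :
    ∑ i, f i = ∑ a, ∑ b, f (fluxOf a b) := by
  have h : ∑ i, f i = f Flux.I + (f Flux.e + (f Flux.m + (f Flux.em + 0))) := rfl
  rw [h]
  simp only [sum_zmod_two, fluxOf, if_true, one_ne_zero, if_false, add_zero]
  abel

theorem fluxState_fluxOf_apply (a b : ZMod 2) (s : M.Edge → ZMod 2) :
    M.fluxState W (fluxOf a b) (bits s) =
      if M.faceMatrix *ᵥ s = 0 ∧ W.z₁ ⬝ᵥ s = a then W.amplitude * sgn (b * (W.z₂ ⬝ᵥ s)) else 0 := by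
  have hx := (M.isDualLoop_iff _).1 W.dual₂
  rcases ZMod.two_eq_zero_or_one a with rfl | rfl <;>
    rcases ZMod.two_eq_zero_or_one b with rfl | rfl <;>
    simp only [fluxOf, if_true, one_ne_zero, if_false, fluxState, xLoop_mulVec, zLoop_mulVec,
      ← Matrix.mulVec_mulVec, trivialFluxState_apply, zero_mul, one_mul, sgn_zero, mul_one,
      ite_mul, Matrix.mulVec_add, dotProduct_add, hx, add_zero, W.dotProduct_z₁_x₂,
      W.dotProduct_z₂_x₂, CharTwo.add_eq_zero, mul_comm (sgn _)]

/-- The superposition with coefficients `c` in the computational basis. -/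
theorem sum_smul_fluxState_apply (c : Flux → ℂ) (s : M.Edge → ZMod 2) :
    (∑ i, c i • M.fluxState W i) (bits s) =
      if M.faceMatrix *ᵥ s = 0 then W.amplitude *
        ∑ b, c (fluxOf (W.z₁ ⬝ᵥ s) b) * sgn (b * (W.z₂ ⬝ᵥ s)) else 0 := by
  rw [sum_flux, Finset.sum_apply]
  simp only [Finset.sum_apply, Pi.smul_apply, fluxState_fluxOf_apply, smul_eq_mul]
  by_cases h : M.faceMatrix *ᵥ s = 0
  · simp only [h, true_and, if_true, mul_ite, mul_zero]
    rw [Finset.sum_comm, Finset.mul_sum]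
    refine Finset.sum_congr rfl fun b _ => ?_
    rw [Finset.sum_ite_eq, if_pos (Finset.mem_univ _)]
    ring
  · simp [h]

end CombMap

/-! ### Ground states -/

theorem re_star_dotProduct_of_sum_norm_sq_eq {ι : Type*} [Fintype ι] {φ χ : ι → ℂ}
    (h : ∑ s, ‖χ s‖ ^ 2 = ∑ s, ‖φ s‖ ^ 2) :
    (star φ ⬝ᵥ χ).re = ∑ s, ‖φ s‖ ^ 2 - (∑ s, ‖φ s - χ s‖ ^ 2) / 2 := by
  have h' : ∑ s, ‖φ s - χ s‖ ^ 2 =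
      ∑ s, ‖φ s‖ ^ 2 + ∑ s, ‖χ s‖ ^ 2 - 2 * (star φ ⬝ᵥ χ).re := by
    rw [dotProduct, Complex.re_sum, Finset.mul_sum, ← Finset.sum_add_distrib,
      ← Finset.sum_sub_distrib]
    refine Finset.sum_congr rfl fun s _ => ?_
    simp only [← Complex.normSq_eq_norm_sq, Complex.normSq_apply, Complex.sub_re, Complex.sub_im,
      Pi.star_apply, Complex.star_def, Complex.mul_re, Complex.conj_re, Complex.conj_im]
    ring
  rw [h', h]
  ring

theorem exists_flux_fun {R : Type*} (g : ZMod 2 → ZMod 2 → R) :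
    ∃ c : CombMap.Flux → R, ∀ a b, c (CombMap.fluxOf a b) = g a b := by
  refine ⟨fun i => match i with
    | .I => g 0 0
    | .e => g 1 0
    | .m => g 0 1
    | .em => g 1 1, fun a b => ?_⟩
  rcases ZMod.two_eq_zero_or_one a with rfl | rfl <;>
    rcases ZMod.two_eq_zero_or_one b with rfl | rfl <;> rfl

namespace CombMap

variable {D : Type*} (M : CombMap D) [Fintype D]

theorem sum_norm_sq_starOp (v : M.Vertex) (φ : (M.Edge → Fin 2) → ℂ) :
    ∑ s, ‖(M.starOp v *ᵥ φ) s‖ ^ 2 = ∑ s, ‖φ s‖ ^ 2 := by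
  rw [sum_bits, sum_bits]
  simp only [starOp_mulVec]
  exact Equiv.sum_comp (Equiv.addRight (M.vertexMatrix v)) fun s => ‖φ (bits s)‖ ^ 2

theorem sum_norm_sq_plaquette (p : M.Face) (φ : (M.Edge → Fin 2) → ℂ) :
    ∑ s, ‖(M.plaquette p *ᵥ φ) s‖ ^ 2 = ∑ s, ‖φ s‖ ^ 2 := by
  rw [sum_bits, sum_bits]
  simp only [plaquette_mulVec, norm_mul, norm_sgn, one_mul]

theorem hamiltonian_mulVec (U J : ℝ) (φ : (M.Edge → Fin 2) → ℂ) :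
    M.hamiltonian U J *ᵥ φ =
      -((U : ℂ) • ∑ v, M.starOp v *ᵥ φ) - (J : ℂ) • ∑ p, M.plaquette p *ᵥ φ := by
  rw [hamiltonian, Matrix.sub_mulVec, Matrix.neg_mulVec, Matrix.smul_mulVec, Matrix.smul_mulVec,
    Matrix.sum_mulVec, Matrix.sum_mulVec]

/-- The excess of an energy eigenvalue over the sum of the lowest eigenvalues of all terms measures
the violation of the stabilizer conditions: star and plaquette operators preserve the norm, so that
`⟨φ, X φ⟩` falls short of `‖φ‖²` by half of `‖φ - X φ‖²`. -/
theorem energy_excess {U J E₁ : ℝ} {φ : (M.Edge → Fin 2) → ℂ}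
    (h : M.hamiltonian U J *ᵥ φ = (E₁ : ℂ) • φ) :
    2 * ((E₁ + (U * Fintype.card M.Vertex + J * Fintype.card M.Face)) * ∑ s, ‖φ s‖ ^ 2) =
      U * ∑ v, ∑ s, ‖φ s - (M.starOp v *ᵥ φ) s‖ ^ 2 +
        J * ∑ p, ∑ s, ‖φ s - (M.plaquette p *ᵥ φ) s‖ ^ 2 := by
  have hre := congrArg (fun χ => (star φ ⬝ᵥ χ).re) h
  have hself : (star φ ⬝ᵥ φ).re = ∑ s, ‖φ s‖ ^ 2 := by
    rw [re_star_dotProduct_of_sum_norm_sq_eq rfl]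
    simp
  simp only [hamiltonian_mulVec, dotProduct_sub, dotProduct_neg, dotProduct_smul, dotProduct_sum,
    Complex.sub_re, Complex.neg_re, smul_eq_mul, Complex.re_ofReal_mul, Complex.re_sum, hself,
    re_star_dotProduct_of_sum_norm_sq_eq (M.sum_norm_sq_starOp _ φ),
    re_star_dotProduct_of_sum_norm_sq_eq (M.sum_norm_sq_plaquette _ φ), Finset.sum_sub_distrib,
    Finset.sum_const, Finset.card_univ, nsmul_eq_mul, ← Finset.sum_div] at hre
  linear_combination (-2) * hre

/-- The states that are fixed by all star and plaquette operators. -/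
def IsStabilized (ψ : (M.Edge → Fin 2) → ℂ) : Prop :=
  (∀ v, M.starOp v *ᵥ ψ = ψ) ∧ ∀ p, M.plaquette p *ᵥ ψ = ψ

variable {M}

theorem IsStabilized.hamiltonian_mulVec {ψ : (M.Edge → Fin 2) → ℂ} (h : M.IsStabilized ψ)
    (U J : ℝ) : M.hamiltonian U J *ᵥ ψ =
      ((-(U * Fintype.card M.Vertex + J * Fintype.card M.Face) : ℝ) : ℂ) • ψ := by
  rw [CombMap.hamiltonian_mulVec]
  ext s
  simp only [h.1, h.2, Finset.sum_const, Finset.card_univ, Pi.sub_apply, Pi.neg_apply,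
    Pi.smul_apply, smul_eq_mul, nsmul_eq_mul, Pi.mul_apply, Pi.natCast_apply, Complex.ofReal_neg,
    Complex.ofReal_add, Complex.ofReal_mul, Complex.ofReal_natCast]
  ring

theorem vertexMatrix_row (v : M.Vertex) :
    M.vertexMatrix v = Pi.single v 1 ᵥ* M.vertexMatrix := (Matrix.single_one_vecMul _ _).symm

theorem isStabilized_sum (W : M.LoopSystem) (c : Flux → ℂ) :
    M.IsStabilized (∑ i, c i • M.fluxState W i) := by
  refine ⟨fun v => eq_of_forall_bits fun s => ?_, fun p => eq_of_forall_bits fun s => ?_⟩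
  · rw [starOp_mulVec, sum_smul_fluxState_apply, sum_smul_fluxState_apply, vertexMatrix_row,
      Matrix.mulVec_add, faceMatrix_mulVec_vecMul, add_zero, dotProduct_add, dotProduct_add,
      M.dotProduct_vecMul_vertexMatrix W.loop₁, M.dotProduct_vecMul_vertexMatrix W.loop₂, add_zero,
      add_zero]
  · rw [plaquette_mulVec, sum_smul_fluxState_apply]
    split_ifs with h
    · rw [h, Pi.zero_apply, sgn_zero, one_mul]
    · rw [mul_zero]

theorem IsStabilized.apply_add_vecMul {ψ : (M.Edge → Fin 2) → ℂ} (h : M.IsStabilized ψ)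
    (f : M.Vertex → ZMod 2) (s : M.Edge → ZMod 2) :
    ψ (bits (s + f ᵥ* M.vertexMatrix)) = ψ (bits s) := by
  rw [Matrix.vecMul_eq_sum]
  revert s
  refine Finset.sum_induction _ (fun t => ∀ s, ψ (bits (s + t)) = ψ (bits s)) ?_ ?_ ?_
  · intro t u ht hu s
    rw [← add_assoc, hu, ht]
  · intro s
    rw [add_zero]
  · intro v _ s
    rcases ZMod.two_eq_zero_or_one (f v) with hv | hv
    · rw [hv, zero_smul, add_zero]
    · rw [hv, one_smul]
      exact (M.starOp_mulVec v ψ s).symm.trans (congrFun (h.1 v) _)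

/-- A stabilized state depends on the crossing numbers of a dual loop only, and is therefore a
superposition of flux states. -/
theorem IsStabilized.exists_eq_sum {ψ : (M.Edge → Fin 2) → ℂ} (h : M.IsStabilized ψ)
    (hM : M.IsTorus) (W : M.LoopSystem) : ∃ c : Flux → ℂ, ψ = ∑ i, c i • M.fluxState W i := by
  have hx₁ := (M.isDualLoop_iff _).1 W.dual₁
  have hx₂ := (M.isDualLoop_iff _).1 W.dual₂
  -- invert the Fourier transformation in the number of crossings with `z₂`
  obtain ⟨c, hc⟩ := exists_flux_fun fun a b' => (2 * (W.amplitude : ℂ))⁻¹ *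
    ∑ b, ψ (bits (a • W.x₂ + b • W.x₁)) * sgn (b' * b)
  refine ⟨c, eq_of_forall_bits fun s => ?_⟩
  rw [sum_smul_fluxState_apply]
  split_ifs with hs
  · have hψ : ψ (bits s) = ψ (bits ((W.z₁ ⬝ᵥ s) • W.x₂ + (W.z₂ ⬝ᵥ s) • W.x₁)) := by
      set u := (W.z₁ ⬝ᵥ s) • W.x₂ + (W.z₂ ⬝ᵥ s) • W.x₁ with hu
      obtain ⟨f, hf⟩ := hM.exists_eq_vecMul_vertexMatrix W (s := s + u)
        (by simp [hu, Matrix.mulVec_add, Matrix.mulVec_smul, hs, hx₁, hx₂])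
        (by simp [hu, dotProduct_add, dotProduct_smul, W.dotProduct_z₁_x₂, W.dotProduct_z₁_x₁,
          CharTwo.add_self_eq_zero])
        (by simp [hu, dotProduct_add, dotProduct_smul, W.dotProduct_z₂_x₂, W.dotProduct_z₂_x₁,
          CharTwo.add_self_eq_zero])
      rw [← h.apply_add_vecMul f, ← hf, ← add_assoc, add_self_eq_zero_of_zmod_two, zero_add]
    have hK : (W.amplitude : ℂ) ≠ 0 := by exact_mod_cast W.amplitude_pos.ne'
    rw [hψ]
    simp only [hc, sum_zmod_two]
    rcases ZMod.two_eq_zero_or_one (W.z₂ ⬝ᵥ s) with hb | hb <;> rw [hb] <;>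
      simp only [mul_zero, mul_one, sgn_zero, sgn_one] <;> field_simp <;> ring
  · by_contra hne
    refine hs (funext fun p => ?_)
    have hp := (M.plaquette_mulVec p ψ s).symm.trans (congrFun (h.2 p) _)
    refine (ZMod.two_eq_zero_or_one _).resolve_right fun h1 => hne ?_
    rw [h1, sgn_one] at hp
    linear_combination (-1 / 2 : ℂ) * hp

/-- A sum over dual loops can be averaged over the translation by a dual loop. -/
theorem two_mul_sum_dualLoops {t : M.Edge → ZMod 2} (ht : M.faceMatrix *ᵥ t = 0)
    (g : (M.Edge → ZMod 2) → ℝ) :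
    2 * ∑ s with M.faceMatrix *ᵥ s = 0, g s =
      ∑ s with M.faceMatrix *ᵥ s = 0, (g s + g (s + t)) := by
  rw [Finset.sum_add_distrib, two_mul]
  congr 1
  refine (Finset.sum_equiv (Equiv.addRight t) (fun s => ?_) fun _ _ => rfl).symm
  simp [Matrix.mulVec_add, ht]

/-- The flux states are orthonormal. Translation by `x₁` averages over the crossings with `z₂`, and
translation by `x₂` over those with `z₁`. -/
theorem stateNorm_sum_sq (W : M.LoopSystem) (c : Flux → ℂ) :
    stateNorm (∑ i, c i • M.fluxState W i) ^ 2 = ∑ i, ‖c i‖ ^ 2 := by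
  have hx₁ := (M.isDualLoop_iff _).1 W.dual₁
  have hx₂ := (M.isDualLoop_iff _).1 W.dual₂
  let m : ZMod 2 → ℝ := fun a => ∑ b, ‖c (fluxOf a b)‖ ^ 2
  have h₁ : 2 * ∑ s with M.faceMatrix *ᵥ s = 0,
      ‖∑ b, c (fluxOf (W.z₁ ⬝ᵥ s) b) * sgn (b * (W.z₂ ⬝ᵥ s))‖ ^ 2 =
        2 * ∑ s with M.faceMatrix *ᵥ s = 0, m (W.z₁ ⬝ᵥ s) := by
    rw [two_mul_sum_dualLoops hx₁, Finset.mul_sum]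
    refine Finset.sum_congr rfl fun s _ => ?_
    simp only [m, dotProduct_add, W.dotProduct_z₁_x₁, W.dotProduct_z₂_x₁, add_zero, sum_zmod_two,
      zero_mul, one_mul, sgn_add, sgn_zero, sgn_one, mul_one]
    generalize c (fluxOf (W.z₁ ⬝ᵥ s) 0) = x
    generalize c (fluxOf (W.z₁ ⬝ᵥ s) 1) = y
    have := parallelogram_law_with_norm ℝ x (y * sgn (W.z₂ ⬝ᵥ s))
    rw [norm_mul, norm_sgn, mul_one] at this
    rw [mul_neg, mul_neg, mul_one, ← sub_eq_add_neg]
    linear_combination this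
  have h₂ : 2 * ∑ s with M.faceMatrix *ᵥ s = 0, m (W.z₁ ⬝ᵥ s) =
      2 * ((W.supportCard : ℝ) * ∑ i, ‖c i‖ ^ 2) := by
    have h₃ : (W.supportCard : ℝ) = ∑ s with M.faceMatrix *ᵥ s = 0,
        if W.z₁ ⬝ᵥ s = 0 then 1 else 0 := by
      rw [LoopSystem.supportCard, ← Finset.filter_filter, Finset.card_filter]
      push_cast
      rfl
    rw [← mul_assoc, h₃, two_mul_sum_dualLoops hx₂, two_mul_sum_dualLoops hx₂, sum_flux,
      Finset.sum_mul]
    refine Finset.sum_congr rfl fun s _ => ?_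
    rw [dotProduct_add, W.dotProduct_z₁_x₂, sum_zmod_two]
    change m _ + m _ = _ * (m 0 + m 1)
    rcases ZMod.two_eq_zero_or_one (W.z₁ ⬝ᵥ s) with h | h <;> rw [h]
    · simp
    · rw [CharTwo.add_self_eq_zero]
      simp [add_comm]
  rw [stateNorm_sq, sum_bits]
  simp only [sum_smul_fluxState_apply, apply_ite norm, norm_zero, ite_pow, norm_mul,
    Complex.norm_real, mul_pow, Real.norm_eq_abs, sq_abs]
  rw [zero_pow two_ne_zero, ← Finset.sum_filter, ← Finset.mul_sum]
  have := W.amplitude_sq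
  linear_combination (W.amplitude ^ 2 / 2) * (h₁ + h₂) + this * ∑ i, ‖c i‖ ^ 2

theorem isGroundState_iff_isStabilized (W : M.LoopSystem) {U J : ℝ} (hU : 0 < U) (hJ : 0 < J)
    (ψ : (M.Edge → Fin 2) → ℂ) :
    IsGroundState (M.hamiltonian U J) ψ ↔ stateNorm ψ = 1 ∧ M.IsStabilized ψ := by
  have hnn : ∀ φ χ : (M.Edge → Fin 2) → ℂ, 0 ≤ ∑ s, ‖φ s - χ s‖ ^ 2 := fun φ χ =>
    Finset.sum_nonneg fun _ _ => sq_nonneg _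
  have heq : ∀ φ χ : (M.Edge → Fin 2) → ℂ, ∑ s, ‖φ s - χ s‖ ^ 2 = 0 → χ = φ := by
    intro φ χ h
    ext s
    have := (Finset.sum_eq_zero_iff_of_nonneg fun _ _ => sq_nonneg _).1 h s (Finset.mem_univ _)
    exact (sub_eq_zero.1 (norm_eq_zero.1 (pow_eq_zero_iff two_ne_zero |>.1 this))).symm
  refine and_congr_right fun hψ => ?_
  constructor
  · rintro ⟨E₀, hE, hmin⟩
    -- compare with the superposition of flux states with all coefficients equal to `1`
    set φ := ∑ i, (fun _ => (1 : ℂ)) i • M.fluxState W i with hφ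
    have hφ0 : φ ≠ 0 := by
      intro h0
      have h := stateNorm_sum_sq W fun _ => 1
      rw [← hφ, h0, sum_flux] at h
      simp [stateNorm] at h
    have hle := hmin _ φ hφ0 ((isStabilized_sum W _).hamiltonian_mulVec U J)
    have hex := M.energy_excess hE
    rw [← stateNorm_sq, hψ] at hex
    have h₁ : 0 ≤ ∑ v, ∑ s, ‖ψ s - (M.starOp v *ᵥ ψ) s‖ ^ 2 :=
      Finset.sum_nonneg fun v _ => hnn _ _
    have h₂ : 0 ≤ ∑ p, ∑ s, ‖ψ s - (M.plaquette p *ᵥ ψ) s‖ ^ 2 :=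
      Finset.sum_nonneg fun p _ => hnn _ _
    have h₁' := mul_nonneg hU.le h₁
    have h₂' := mul_nonneg hJ.le h₂
    have h₃ := (mul_eq_zero.1 (le_antisymm (by linarith) h₁')).resolve_left hU.ne'
    have h₄ := (mul_eq_zero.1 (le_antisymm (by linarith) h₂')).resolve_left hJ.ne'
    exact ⟨fun v => heq _ _ ((Finset.sum_eq_zero_iff_of_nonneg fun v _ => hnn _ _).1 h₃ v
      (Finset.mem_univ _)), fun p => heq _ _ ((Finset.sum_eq_zero_iff_of_nonneg
        fun p _ => hnn _ _).1 h₄ p (Finset.mem_univ _))⟩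
  · intro h
    refine ⟨_, h.hamiltonian_mulVec U J, fun E₁ φ hφ hE => ?_⟩
    have hex := M.energy_excess hE
    have hpos : 0 < ∑ s, ‖φ s‖ ^ 2 := by
      obtain ⟨s, hs⟩ := Function.ne_iff.1 hφ
      exact Finset.sum_pos' (fun _ _ => sq_nonneg _)
        ⟨s, Finset.mem_univ _, pow_pos (norm_pos_iff.2 hs) 2⟩
    have h₁ := mul_nonneg hU.le (Finset.sum_nonneg fun v (_ : v ∈ Finset.univ) =>
      hnn φ (M.starOp v *ᵥ φ))
    have h₂ := mul_nonneg hJ.le (Finset.sum_nonneg fun p (_ : p ∈ Finset.univ) =>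
      hnn φ (M.plaquette p *ᵥ φ))
    have h₃ := nonneg_of_mul_nonneg_left (by linarith :
      0 ≤ (E₁ + (U * Fintype.card M.Vertex + J * Fintype.card M.Face)) * ∑ s, ‖φ s‖ ^ 2) hpos
    linarith

theorem IsTorus.isGroundState_iff (hM : M.IsTorus) (W : M.LoopSystem) {U J : ℝ} (hU : 0 < U)
    (hJ : 0 < J) (ψ : (M.Edge → Fin 2) → ℂ) :
    IsGroundState (M.hamiltonian U J) ψ ↔
      ∃ c : Flux → ℂ, ∑ i, ‖c i‖ ^ 2 = 1 ∧ ψ = ∑ i, c i • M.fluxState W i := by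
  rw [isGroundState_iff_isStabilized W hU hJ]
  constructor
  · rintro ⟨hψ, h⟩
    obtain ⟨c, rfl⟩ := h.exists_eq_sum hM W
    exact ⟨c, by rw [← stateNorm_sum_sq W, hψ, one_pow], rfl⟩
  · rintro ⟨c, hc, rfl⟩
    refine ⟨?_, isStabilized_sum W c⟩
    rw [← stateNorm_sum_sq W] at hc
    exact (pow_eq_one_iff_of_nonneg (Real.sqrt_nonneg _) two_ne_zero).1 hc

end CombMap

/-! ### Logarithmic negativity -/

open scoped ComplexOrder in
/-- For an isometry `W`, the absolute value of `W N Wᴴ` is `W |N| Wᴴ`, and has the same trace as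
`|N|`. -/
theorem trace_abs_of_isometry {m n : Type*} [Fintype m] [DecidableEq m] [Fintype n] [DecidableEq n]
    {W : Matrix m n ℂ} (hW : Wᴴ * W = 1) {N : Matrix n n ℂ} {g : n → ℝ} (hg : ∀ i, 0 ≤ g i)
    (hN : Nᴴ * N = Matrix.diagonal fun i => ((g i : ℝ) : ℂ) ^ 2) :
    (CFC.abs (W * N * Wᴴ)).trace = ((∑ i, g i : ℝ) : ℂ) := by
  have habs : CFC.abs (W * N * Wᴴ) = W * Matrix.diagonal (fun i => ((g i : ℝ) : ℂ)) * Wᴴ := by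
    refine CFC.sqrt_unique ?_ ?_
    · calc W * Matrix.diagonal (fun i => ((g i : ℝ) : ℂ)) * Wᴴ *
            (W * Matrix.diagonal (fun i => ((g i : ℝ) : ℂ)) * Wᴴ)
          = W * (Matrix.diagonal (fun i => ((g i : ℝ) : ℂ)) * (Wᴴ * W) *
            Matrix.diagonal (fun i => ((g i : ℝ) : ℂ))) * Wᴴ := by
            simp only [Matrix.mul_assoc]
        _ = W * (Nᴴ * (Wᴴ * W) * N) * Wᴴ := by
            rw [hW, Matrix.mul_one, Matrix.mul_one, hN, Matrix.diagonal_mul_diagonal]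
            simp only [sq]
        _ = star (W * N * Wᴴ) * (W * N * Wᴴ) := by
            rw [Matrix.star_eq_conjTranspose, Matrix.conjTranspose_mul, Matrix.conjTranspose_mul,
              Matrix.conjTranspose_conjTranspose]
            simp only [Matrix.mul_assoc]
    · rw [Matrix.nonneg_iff_posSemidef]
      refine Matrix.PosSemidef.mul_mul_conjTranspose_same ?_ W
      exact Matrix.posSemidef_diagonal_iff.2 fun i => Complex.zero_le_real.2 (hg i)
  rw [habs, Matrix.trace_mul_comm, ← Matrix.mul_assoc, hW, Matrix.one_mul, Matrix.trace_diagonal,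
    Complex.ofReal_sum]

theorem partialTranspose_pureState_apply {E : Type*} [Fintype E] [DecidableEq E] (A : Finset E)
    (ψ : (E → Fin 2) → ℂ) (s t : E → ZMod 2) :
    partialTranspose A (pureState ψ) (bits s) (bits t) =
      ψ (bits (restrict A t + restrict Aᶜ s)) * star (ψ (bits (restrict A s + restrict Aᶜ t))) := by
  have h : ∀ s t : E → ZMod 2,
      A.piecewise (bits t) (bits s) = bits (restrict A t + restrict Aᶜ s) := by
    intro s t
    have : A.piecewise t s = restrict A t + restrict Aᶜ s := by
      ext e
      by_cases he : e ∈ A <;> simp [restrict_apply, he]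
    exact this
  rw [partialTranspose, Matrix.of_apply, pureState, Matrix.vecMulVec_apply, h, h, Pi.star_apply]

namespace CombMap

variable {D : Type*} {M : CombMap D} [Fintype D]

variable (M) in
/-- The number of configurations whose parts in the two regions both have flux `0`. By translation
it is also the number of those whose parts have any given shared fluxes (`card_sector`). -/
def sectorCard (A : Finset M.Edge) : ℕ :=
  (Finset.univ.filter fun s : M.Edge → ZMod 2 =>
    M.regionFlux A s = 0 ∧ M.regionFlux Aᶜ s = 0).card

theorem sum_sector_add {R : Type*} [AddCommMonoid R] (A : Finset M.Edge) {t : M.Edge → ZMod 2}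
    (g : (M.Edge → ZMod 2) → R) (r r' : M.Face → ZMod 2) :
    ∑ s with M.regionFlux A s = r ∧ M.regionFlux Aᶜ s = r', g (s + t) =
      ∑ s with M.regionFlux A s = r + M.regionFlux A t ∧
        M.regionFlux Aᶜ s = r' + M.regionFlux Aᶜ t, g s := by
  refine Finset.sum_equiv (Equiv.addRight t) (fun s => ?_) fun _ _ => rfl
  simp

theorem card_sector {A : Finset M.Edge} {r r' : M.Face → ZMod 2}
    (hr : r ∈ M.sharedFlux A) (hr' : r' ∈ M.sharedFlux A) :
    (Finset.univ.filter fun s : M.Edge → ZMod 2 =>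
      M.regionFlux A s = r ∧ M.regionFlux Aᶜ s = r').card = M.sectorCard A := by
  obtain ⟨t, rfl, rfl⟩ := M.exists_of_mem_sharedFlux hr hr'
  have h := sum_sector_add A (t := t) (fun _ => 1) 0 0
  rw [zero_add, zero_add, ← Finset.card_eq_sum_ones, ← Finset.card_eq_sum_ones] at h
  exact h.symm

theorem sectorCard_pos (A : Finset M.Edge) : 0 < M.sectorCard A :=
  Finset.card_pos.2 ⟨0, by simp⟩

/-- The characters of the crossing number with `z`, split between the two regions, are orthogonal on
each sector if either region contains a dual loop that crosses `z` oddly. -/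
theorem sum_sgn_sector {A : Finset M.Edge} {z δ δ' : M.Edge → ZMod 2}
    (hδ : M.faceMatrix *ᵥ δ = 0) (hδA : ∀ e, δ e ≠ 0 → e ∈ A) (hδz : z ⬝ᵥ δ = 1)
    (hδ' : M.faceMatrix *ᵥ δ' = 0) (hδA' : ∀ e, δ' e ≠ 0 → e ∈ Aᶜ) (hδz' : z ⬝ᵥ δ' = 1)
    {r r' : M.Face → ZMod 2} (hr : r ∈ M.sharedFlux A) (hr' : r' ∈ M.sharedFlux A) (a b : ZMod 2) :
    ∑ s with M.regionFlux A s = r ∧ M.regionFlux Aᶜ s = r',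
      sgn (a * (z ⬝ᵥ restrict A s)) * sgn (b * (z ⬝ᵥ restrict Aᶜ s)) =
        if a = 0 ∧ b = 0 then (M.sectorCard A : ℂ) else 0 := by
  have hδB := restrict_compl_eq_zero hδA
  have hδB' := restrict_compl_eq_zero hδA'
  rw [compl_compl] at hδB'
  have hself := restrict_eq_self hδA
  have hself' := restrict_eq_self hδA'
  have hzero : ∀ x : ℂ, x = -x → x = 0 := fun x hx => by linear_combination (1 / 2 : ℂ) * hx
  rcases ZMod.two_eq_zero_or_one a with rfl | rfl
  · rcases ZMod.two_eq_zero_or_one b with rfl | rfl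
    · simp only [zero_mul, sgn_zero, mul_one, Finset.sum_const, card_sector hr hr', nsmul_eq_mul,
        and_self, if_true]
    · rw [if_neg (by simp)]
      refine hzero _ ?_
      have h := sum_sector_add A (t := δ') (fun s => sgn (0 * (z ⬝ᵥ restrict A s)) *
        sgn (1 * (z ⬝ᵥ restrict Aᶜ s))) r r'
      rw [regionFlux_apply, regionFlux_apply, hself', hδB', Matrix.mulVec_zero, hδ', add_zero,
        add_zero] at h
      refine h.symm.trans ?_
      rw [← Finset.sum_neg_distrib]
      refine Finset.sum_congr rfl fun s _ => ?_
      rw [map_add, map_add, hself', dotProduct_add, dotProduct_add, hδz', zero_mul, zero_mul,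
        mul_add, mul_one, sgn_add, sgn_one]
      ring
  · rw [if_neg (by simp)]
    refine hzero _ ?_
    have h := sum_sector_add A (t := δ) (fun s => sgn (1 * (z ⬝ᵥ restrict A s)) *
      sgn (b * (z ⬝ᵥ restrict Aᶜ s))) r r'
    rw [regionFlux_apply, regionFlux_apply, hself, hδB, Matrix.mulVec_zero, hδ, add_zero,
      add_zero] at h
    refine h.symm.trans ?_
    rw [← Finset.sum_neg_distrib]
    refine Finset.sum_congr rfl fun s _ => ?_
    rw [map_add, map_add, hself, hδB, add_zero, dotProduct_add, hδz, mul_add, mul_one, sgn_add,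
      sgn_one]
    ring

variable (M) in
/-- The labels of the Schmidt vectors: a shared flux and a character of `ℤ/2`, applied to the
crossings with a loop. -/
abbrev SchmidtIndex (A : Finset M.Edge) : Type _ := M.sharedFlux A × ZMod 2

variable (M) in
/-- The unnormalized Schmidt vectors of the region `R`, which is `A` or its complement. They are
functions of the whole configuration that depend on its part in `R` only. -/
def schmidtVector (A R : Finset M.Edge) (z : M.Edge → ZMod 2) (k : M.SchmidtIndex A)
    (s : M.Edge → ZMod 2) : ℂ :=
  if M.regionFlux R s = k.1 then sgn (k.2 * (z ⬝ᵥ restrict R s)) else 0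

theorem star_schmidtVector (A R : Finset M.Edge) (z : M.Edge → ZMod 2) (k : M.SchmidtIndex A)
    (s : M.Edge → ZMod 2) : star (M.schmidtVector A R z k s) = M.schmidtVector A R z k s := by
  rw [schmidtVector]
  split_ifs
  · exact star_sgn _
  · exact star_zero _

variable (M) in
/-- The normalized products of Schmidt vectors of `A` and of its complement, as the columns of a
matrix. -/
def schmidtMatrix (A : Finset M.Edge) (z : M.Edge → ZMod 2) :
    Matrix (M.Edge → Fin 2) (M.SchmidtIndex A × M.SchmidtIndex A) ℂ :=
  Matrix.of fun s p => (((√(M.sectorCard A : ℝ))⁻¹ : ℝ) : ℂ) *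
    (M.schmidtVector A A z p.1 (bits.symm s) * M.schmidtVector A Aᶜ z p.2 (bits.symm s))

theorem inv_sqrt_sectorCard_sq (A : Finset M.Edge) :
    (((√(M.sectorCard A : ℝ))⁻¹ : ℝ) : ℂ) * (((√(M.sectorCard A : ℝ))⁻¹ : ℝ) : ℂ) *
      (M.sectorCard A : ℂ) = 1 := by
  have h : (0 : ℝ) < M.sectorCard A := Nat.cast_pos.2 (sectorCard_pos A)
  rw [← Complex.ofReal_mul, ← mul_inv, Real.mul_self_sqrt h.le, ← Complex.ofReal_natCast,
    ← Complex.ofReal_mul, inv_mul_cancel₀ h.ne', Complex.ofReal_one]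

theorem schmidtMatrix_isometry {A : Finset M.Edge} {z δ δ' : M.Edge → ZMod 2}
    (hδ : M.faceMatrix *ᵥ δ = 0) (hδA : ∀ e, δ e ≠ 0 → e ∈ A) (hδz : z ⬝ᵥ δ = 1)
    (hδ' : M.faceMatrix *ᵥ δ' = 0) (hδA' : ∀ e, δ' e ≠ 0 → e ∈ Aᶜ) (hδz' : z ⬝ᵥ δ' = 1) :
    (M.schmidtMatrix A z)ᴴ * M.schmidtMatrix A z = 1 := by
  ext ⟨⟨r₁, i₁⟩, ⟨r₂, i₂⟩⟩ ⟨⟨r₁', i₁'⟩, ⟨r₂', i₂'⟩⟩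
  rw [Matrix.mul_apply, sum_bits]
  simp only [Matrix.conjTranspose_apply, schmidtMatrix, Matrix.of_apply, Equiv.symm_apply_apply,
    star_mul', star_schmidtVector, Complex.star_def, Complex.conj_ofReal]
  rw [Matrix.one_apply]
  by_cases hr : r₁ = r₁' ∧ r₂ = r₂'
  · obtain ⟨rfl, rfl⟩ := hr
    have h := sum_sgn_sector hδ hδA hδz hδ' hδA' hδz' r₁.2 r₂.2 (i₁ + i₁') (i₂ + i₂')
    rw [Finset.sum_filter] at h
    rw [Finset.sum_congr rfl (g := fun s => ((((√(M.sectorCard A : ℝ))⁻¹ : ℝ) : ℂ) *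
      (((√(M.sectorCard A : ℝ))⁻¹ : ℝ) : ℂ)) *
        if M.regionFlux A s = r₁ ∧ M.regionFlux Aᶜ s = r₂ then
          sgn ((i₁ + i₁') * (z ⬝ᵥ restrict A s)) * sgn ((i₂ + i₂') * (z ⬝ᵥ restrict Aᶜ s)) else 0),
      ← Finset.mul_sum, h]
    · simp only [CharTwo.add_eq_zero, Prod.mk.injEq, true_and]
      split_ifs
      · exact inv_sqrt_sectorCard_sq A
      · rw [mul_zero]
    · intro s _
      simp only [schmidtVector, add_mul, sgn_add]
      by_cases h₁ : M.regionFlux A s = r₁ <;> by_cases h₂ : M.regionFlux Aᶜ s = r₂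
      · simp only [h₁, h₂, and_self, if_true]
        rw [mul_mul_mul_comm, mul_mul_mul_comm (sgn _)]
      all_goals simp [h₁, h₂]
  · rw [if_neg (by
      simp only [Prod.mk.injEq, not_and]
      intro h₁ h₂
      exact absurd ⟨h₁.1, h₂⟩ hr)]
    refine Finset.sum_eq_zero fun s _ => ?_
    simp only [schmidtVector]
    by_cases h₁ : M.regionFlux A s = r₁ <;> by_cases h₂ : M.regionFlux Aᶜ s = r₂
    · have : ¬ (M.regionFlux A s = r₁' ∧ M.regionFlux Aᶜ s = r₂') := fun h =>
        hr ⟨Subtype.ext (h₁.symm.trans h.1), Subtype.ext (h₂.symm.trans h.2)⟩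
      rw [not_and_or] at this
      rcases this with h | h <;> simp [h]
    all_goals simp [h₁, h₂]

/-- The Schmidt decomposition of a superposition of flux states, with the parts of the configuration
in the two regions taken from `t` and from `s`. -/
theorem sum_smul_fluxState_apply_restrict (W : M.LoopSystem) {A : Finset M.Edge}
    {T₀ : M.Face → ZMod 2}
    (hT₀ : ∀ s, M.faceMatrix *ᵥ s = 0 → T₀ ⬝ᵥ M.regionFlux A s = W.z₁ ⬝ᵥ s) (c : Flux → ℂ)
    (s t : M.Edge → ZMod 2) :
    (∑ i, c i • M.fluxState W i) (bits (restrict A t + restrict Aᶜ s)) =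
      W.amplitude * ∑ k : M.SchmidtIndex A, c (fluxOf (T₀ ⬝ᵥ (k.1 : M.Face → ZMod 2)) k.2) *
        (M.schmidtVector A A W.z₂ k t * M.schmidtVector A Aᶜ W.z₂ k s) := by
  set u := restrict A t + restrict Aᶜ s with hu
  have hA : M.regionFlux A u = M.regionFlux A t := by
    rw [regionFlux_apply, hu, map_add, restrict_restrict, restrict_restrict_compl, add_zero,
      ← regionFlux_apply]
  have hB : M.regionFlux Aᶜ u = M.regionFlux Aᶜ s := by
    rw [regionFlux_apply, hu, map_add, restrict_restrict, restrict_compl_restrict, zero_add,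
      ← regionFlux_apply]
  rw [sum_smul_fluxState_apply]
  by_cases h : M.faceMatrix *ᵥ u = 0
  · have h' := (M.faceMatrix_mulVec_eq_zero_iff A u).1 h
    rw [hA, hB] at h'
    rw [if_pos h, ← hT₀ u h, hA, Fintype.sum_prod_type, Fintype.sum_eq_single
      (⟨M.regionFlux A t, ⟨_, rfl⟩, h' ▸ ⟨_, rfl⟩⟩ : M.sharedFlux A)]
    · congr 1
      refine Finset.sum_congr rfl fun b _ => ?_
      simp only [schmidtVector, h', if_true]
      rw [hu, dotProduct_add, mul_add, sgn_add]
    · intro r hr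
      refine Finset.sum_eq_zero fun b _ => ?_
      rw [schmidtVector, if_neg (fun e => hr (Subtype.ext e.symm)), zero_mul, mul_zero]
  · rw [if_neg h, eq_comm]
    refine mul_eq_zero_of_right _ (Finset.sum_eq_zero fun k _ => ?_)
    by_cases h₁ : M.regionFlux A t = k.1
    · have h₂ : M.regionFlux Aᶜ s ≠ k.1 := fun h₂ =>
        h ((M.faceMatrix_mulVec_eq_zero_iff A u).2 (by rw [hA, hB, h₁, h₂]))
      rw [schmidtVector, schmidtVector, if_neg h₂, mul_zero, mul_zero]
    · rw [schmidtVector, if_neg h₁, zero_mul, mul_zero]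

/-- The support of the trivial flux state is the union of the sectors of the shared fluxes that
belong to even crossings with `z₁`. -/
theorem supportCard_eq (W : M.LoopSystem) {A : Finset M.Edge} {T₀ : M.Face → ZMod 2}
    (hT₀ : ∀ s, M.faceMatrix *ᵥ s = 0 → T₀ ⬝ᵥ M.regionFlux A s = W.z₁ ⬝ᵥ s) :
    W.supportCard = (Finset.univ.filter fun r : M.sharedFlux A =>
      T₀ ⬝ᵥ (r : M.Face → ZMod 2) = 0).card * M.sectorCard A := by
  classical
  rw [LoopSystem.supportCard, Finset.card_eq_sum_card_fiberwise (f := M.regionFlux A)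
    (t := (Finset.univ.filter fun r : M.sharedFlux A =>
      T₀ ⬝ᵥ (r : M.Face → ZMod 2) = 0).map (Function.Embedding.subtype _)), Finset.sum_map,
      Finset.sum_congr rfl (g := fun _ => M.sectorCard A), Finset.sum_const, smul_eq_mul]
  · intro r hr
    rw [← card_sector r.2 r.2, Finset.filter_filter]
    congr 1
    refine Finset.filter_congr fun s _ => ?_
    rw [Finset.mem_filter] at hr
    simp only [Function.Embedding.subtype_apply]
    constructor
    · rintro ⟨⟨h₁, -⟩, h₂⟩
      exact ⟨h₂, by rw [← (M.faceMatrix_mulVec_eq_zero_iff A s).1 h₁, h₂]⟩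
    · rintro ⟨h₁, h₂⟩
      have h := (M.faceMatrix_mulVec_eq_zero_iff A s).2 (h₁.trans h₂.symm)
      exact ⟨⟨h, by rw [← hT₀ s h, h₁, hr.2]⟩, h₁⟩
  · intro s hs
    rw [Finset.mem_coe, Finset.mem_filter] at hs
    have h := (M.faceMatrix_mulVec_eq_zero_iff A s).1 hs.2.1
    rw [Finset.mem_coe, Finset.mem_map]
    exact ⟨⟨M.regionFlux A s, ⟨_, rfl⟩, h ▸ ⟨_, rfl⟩⟩, by simp [hT₀ s hs.2.1, hs.2.2], rfl⟩

/-- The trace norm of the partial transpose of a superposition of flux states: the partial transpose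
is conjugate to a weighted permutation of the pairs of Schmidt vectors. -/
theorem IsTorus.trace_abs_partialTranspose (hM : M.IsTorus) (W : M.LoopSystem)
    {A : Finset M.Edge} (hA : M.WindsAlong A W.z₁) (hB : M.WindsAlong Aᶜ W.z₁)
    (hcut : ∀ v, Nat.card {d : D // M.IsCut A d ∧ M.vertex d = v} ≤ 2)
    {T₀ : M.Face → ZMod 2}
    (hT₀ : ∀ s, M.faceMatrix *ᵥ s = 0 → T₀ ⬝ᵥ M.regionFlux A s = W.z₁ ⬝ᵥ s) (c : Flux → ℂ) :
    (CFC.abs (partialTranspose A (pureState (∑ i, c i • M.fluxState W i)))).trace =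
      ((W.amplitude ^ 2 * M.sectorCard A * (∑ r : M.sharedFlux A, ∑ b,
        ‖c (fluxOf (T₀ ⬝ᵥ (r : M.Face → ZMod 2)) b)‖) ^ 2 : ℝ) : ℂ) := by
  classical
  obtain ⟨δ, hδ, hδA, -, hδz⟩ := hM.exists_dual W hA hB hcut
  obtain ⟨δ', hδ', hδA', -, hδz'⟩ := hM.exists_dual W hB (by rwa [compl_compl])
    (by simpa only [isCut_compl] using hcut)
  have hiso := schmidtMatrix_isometry hδ hδA hδz hδ' hδA' hδz'
  let f : M.SchmidtIndex A → ℂ := fun k => c (fluxOf (T₀ ⬝ᵥ (k.1 : M.Face → ZMod 2)) k.2)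
  let w : ℝ := W.amplitude ^ 2 * M.sectorCard A
  have hw : 0 ≤ w := by positivity
  let N : Matrix (M.SchmidtIndex A × M.SchmidtIndex A) (M.SchmidtIndex A × M.SchmidtIndex A) ℂ :=
    Matrix.of fun p q => if p.swap = q then w * (f p.2 * star (f p.1)) else 0
  have hN : Nᴴ * N = Matrix.diagonal fun p => ((w * (‖f p.1‖ * ‖f p.2‖) : ℝ) : ℂ) ^ 2 := by
    ext p q
    rw [Matrix.mul_apply, Fintype.sum_eq_single p.swap, Matrix.diagonal_apply]
    · simp only [N, Matrix.conjTranspose_apply, Matrix.of_apply, Prod.swap_swap, if_true]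
      split_ifs
      · simp only [Prod.fst_swap, Prod.snd_swap]
        rw [Complex.star_def, Complex.conj_mul', norm_mul, norm_mul, Complex.norm_real,
          Real.norm_of_nonneg hw, RCLike.norm_conj]
      · rw [mul_zero]
    · intro x hx
      have : x.swap ≠ p := fun h => hx (by rw [← h, Prod.swap_swap])
      simp only [N, Matrix.conjTranspose_apply, Matrix.of_apply, if_neg this, star_zero, zero_mul]
  have hO : partialTranspose A (pureState (∑ i, c i • M.fluxState W i)) =
      M.schmidtMatrix A W.z₂ * N * (M.schmidtMatrix A W.z₂)ᴴ := by
    ext s' t'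
    obtain ⟨s, rfl⟩ := bits.surjective s'
    obtain ⟨t, rfl⟩ := bits.surjective t'
    rw [partialTranspose_pureState_apply, sum_smul_fluxState_apply_restrict W hT₀,
      sum_smul_fluxState_apply_restrict W hT₀, Matrix.mul_assoc, Matrix.mul_apply]
    have hNW : ∀ p, (N * (M.schmidtMatrix A W.z₂)ᴴ) p (bits t) =
        w * (f p.2 * star (f p.1)) * star (M.schmidtMatrix A W.z₂ (bits t) p.swap) := by
      intro p
      rw [Matrix.mul_apply, Fintype.sum_eq_single p.swap]
      · simp only [N, Matrix.of_apply, if_true, Matrix.conjTranspose_apply]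
      · intro q hq
        simp only [N, Matrix.of_apply, if_neg (Ne.symm hq), zero_mul]
    simp only [hNW]
    simp only [schmidtMatrix, Matrix.of_apply, Equiv.symm_apply_apply, star_mul', star_sum,
      star_schmidtVector, Complex.star_def, Complex.conj_ofReal, Prod.fst_swap, Prod.snd_swap]
    rw [mul_mul_mul_comm, Finset.sum_mul_sum, Finset.sum_comm, Finset.mul_sum]
    refine Eq.trans (Finset.sum_congr rfl fun l _ => ?_) (Fintype.sum_prod_type _).symm
    rw [Finset.mul_sum]
    refine Finset.sum_congr rfl fun k _ => ?_
    have hcard := inv_sqrt_sectorCard_sq A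
    simp only [w, f]
    rw [Complex.ofReal_mul, Complex.ofReal_pow, Complex.ofReal_natCast]
    generalize (((√(M.sectorCard A : ℝ))⁻¹ : ℝ) : ℂ) = x at hcard ⊢
    linear_combination (-(W.amplitude : ℂ) ^ 2 *
      (c (fluxOf (T₀ ⬝ᵥ (k.1 : M.Face → ZMod 2)) k.2) *
        (starRingEnd ℂ) (c (fluxOf (T₀ ⬝ᵥ (l.1 : M.Face → ZMod 2)) l.2)) *
        M.schmidtVector A A W.z₂ k t * M.schmidtVector A Aᶜ W.z₂ k s *
        M.schmidtVector A A W.z₂ l s * M.schmidtVector A Aᶜ W.z₂ l t)) * hcard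
  rw [hO, trace_abs_of_isometry hiso (fun p => by positivity) hN]
  congr 1
  have hsq : ∑ p : M.SchmidtIndex A × M.SchmidtIndex A, ‖f p.1‖ * ‖f p.2‖ = (∑ k, ‖f k‖) ^ 2 := by
    rw [Fintype.sum_prod_type, sq, Finset.sum_mul_sum]
  rw [← Finset.mul_sum, hsq, Fintype.sum_prod_type]

theorem IsTorus.logNegativity_eq (hM : M.IsTorus) (W : M.LoopSystem)
    {A : Finset M.Edge} (hA : M.WindsAlong A W.z₁) (hB : M.WindsAlong Aᶜ W.z₁)
    (hcut : ∀ v, Nat.card {d : D // M.IsCut A d ∧ M.vertex d = v} ≤ 2)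
    {Γ₁ Γ₂ : M.Boundary A} (hne : Γ₁ ≠ Γ₂) (htwo : ∀ Γ : M.Boundary A, Γ = Γ₁ ∨ Γ = Γ₂)
    {c : Flux → ℂ} (hc : ∑ i, ‖c i‖ ^ 2 = 1) :
    logNegativity A (pureState (∑ i, c i • M.fluxState W i)) =
      2 * Real.logb 2 (∑ i, ‖c i‖) +
        ((M.numPlaquettes A Γ₁ : ℝ) - 1) + ((M.numPlaquettes A Γ₂ : ℝ) - 1) := by
  obtain ⟨T₀, hT₀, hT₀'⟩ := exists_dotProduct_regionFlux_eq hA hB W.loop₁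
  have hcard := hM.card_sharedFlux W hA hB hcut hne htwo hT₀ hT₀'
  set n := 2 ^ (M.numPlaquettes A Γ₁ - 1) * 2 ^ (M.numPlaquettes A Γ₂ - 1) with hn
  have hsum : ∑ r : M.sharedFlux A, ∑ b, ‖c (fluxOf (T₀ ⬝ᵥ (r : M.Face → ZMod 2)) b)‖ =
      n * ∑ i, ‖c i‖ := by
    rw [← Finset.sum_fiberwise _ fun r : M.sharedFlux A => T₀ ⬝ᵥ (r : M.Face → ZMod 2), sum_flux,
      Finset.mul_sum]
    refine Finset.sum_congr rfl fun a _ => ?_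
    rw [Finset.sum_congr rfl (g := fun _ => ∑ b, ‖c (fluxOf a b)‖) (by
      intro r hr
      rw [(Finset.mem_filter.1 hr).2]), Finset.sum_const, hcard, nsmul_eq_mul]
  have hamp := W.amplitude_sq
  rw [supportCard_eq W hT₀', hcard, Nat.cast_mul] at hamp
  have htrace : W.amplitude ^ 2 * M.sectorCard A * (n * ∑ i, ‖c i‖) ^ 2 =
      n * (∑ i, ‖c i‖) ^ 2 := by
    linear_combination (n * (∑ i, ‖c i‖) ^ 2) * hamp
  have hpos : 0 < ∑ i, ‖c i‖ := by
    refine lt_of_le_of_ne (Finset.sum_nonneg fun _ _ => norm_nonneg _) fun h => ?_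
    have h0 := (Finset.sum_eq_zero_iff_of_nonneg fun i _ => norm_nonneg (c i)).1 h.symm
    rw [Finset.sum_eq_zero fun i hi => by rw [h0 i hi, zero_pow two_ne_zero]] at hc
    exact zero_ne_one hc
  have hpow : ∀ m : ℕ, 0 < m → Real.logb 2 (2 ^ (m - 1)) = (m : ℝ) - 1 := by
    intro m hm
    rw [Real.logb_pow, Real.logb_self_eq_one one_lt_two, mul_one, Nat.cast_pred hm]
  rw [logNegativity, hM.trace_abs_partialTranspose W hA hB hcut hT₀', Complex.ofReal_re, hsum,
    htrace, hn]
  push_cast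
  rw [Real.logb_mul (by positivity) (by positivity), Real.logb_mul (by positivity) (by positivity),
    hpow _ (numPlaquettes_pos _), hpow _ (numPlaquettes_pos _), Real.logb_pow]
  push_cast
  ring

end CombMap

end

theorem mainTheorem1 {D : Type*} [Finite D] (M : CombMap D) (hM : M.IsTorus)
    (U J : ℝ) (hU : 0 < U) (hJ : 0 < J) (W : M.LoopSystem)
    (A : Finset M.Edge) (hA : M.WindsAlong A W.z₁) (hB : M.WindsAlong Aᶜ W.z₁)
    (hsimple : M.HasSimpleBoundary A) (Γ₁ Γ₂ : M.Boundary A) (hne : Γ₁ ≠ Γ₂)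
    (htwo : ∀ Γ : M.Boundary A, Γ = Γ₁ ∨ Γ = Γ₂) :
    (∀ ψ : (M.Edge → Fin 2) → ℂ, IsGroundState (M.hamiltonian U J) ψ ↔
      ∃ c : CombMap.Flux → ℂ, ∑ i, ‖c i‖ ^ 2 = 1 ∧ ψ = ∑ i, c i • M.fluxState W i) ∧
    ∀ c : CombMap.Flux → ℂ, ∑ i, ‖c i‖ ^ 2 = 1 →
      logNegativity A (pureState (∑ i, c i • M.fluxState W i)) =
        2 * Real.logb 2 (∑ i, ‖c i‖) +
          ((M.numPlaquettes A Γ₁ : ℝ) - 1) + ((M.numPlaquettes A Γ₂ : ℝ) - 1) := by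
  have := Fintype.ofFinite D
  exact ⟨hM.isGroundState_iff W hU hJ, fun c hc =>
    hM.logNegativity_eq W hA hB hsimple.1 hne htwo hc⟩
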